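/- \textbf{Setting.} There are $n$ agents. A randomized algorithm $A$ is a (measurable) map assigning to every profile $v\in[0,\infty)^n$ a probability distribution over sets $S\subseteq\{1,\dots,n\}$ of agents to serve. An arbitrary cost function $c(S)\in\mathbb R\cup\{+\infty\}$ is given. Values $v_i\sim F_i$ are drawn independently, where each $F_i$ is a probability distribution on $[0,\infty)$ with finite mean and no atoms (in particular, any distribution with a density and finite mean). Write $A(v)=\mathbb E\big[\sum_{i\in S}v_i-c(S)\big]$ for the expected welfare of $A$ on $v$ (which is $-\infty$ if some $S$ with $c(S)=\infty$ has positive probability), $\mathrm{W}(A)=\mathbb E_v[A(v)]$, and $\mathrm{OPT}=\mathbb E_v\big[\max_S\big(\sum_{i\in S}v_i-c(S)\big)\big]$. For $\beta>0$, $A$ is a Bayesian $\beta$-approximation if $\mathrm W(A)\ge \mathrm{OPT}/\beta$. Let $x_i(b)$ be the interim allocation rule of $A$: the probability that $i$ is served when bidding $b$ while the other bids are drawn from $F_{-i}$. A mechanism (an algorithm together with a payment rule) is BIC if for every agent $i$, every value $t$ and every bid $b$, $t\,x_i(t)-p_i(t)\ge t\,x_i(b)-p_i(b)$, where $x_i,p_i$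 are its interim allocation and interim expected payment. \textbf{Ironing.} For each agent $i$ let $F_i^{-1}(q)=\inf\{v: q\le F_i(v)\}$, $G_i(q)=\int_0^q x_i(F_i^{-1}(z))\,dz$ for $q\in[0,1]$, and let $\bar G_i$ be the convex hull of $G_i$ (the largest convex function on $[0,1]$ below $G_i$). Let $\mathcal I_i$ be the set of maximal intervals of $\{v: G_i(F_i(v))>\bar G_i(F_i(v))\}$. The ironed algorithm $\bar A$ independently replaces each bid $v_i$ lying in some $I\in\mathcal I_i$ by a draw $\bar v_i$ from $F_i$ conditioned on $I$, keeps $\bar v_i=v_i$ otherwise, and runs $A(\bar v)$. \textbf{Theorem.} Let $A$ be a Bayesian $\beta$-approximation. Then: \begin{enumerate} \item Each redraw $v_i\mapsto\bar v_i$ is a well-defined probability kernel, and if $v_i\sim F_i$ then $\bar v_i\sim F_i$. The ironed algorithm $\bar A$ is a randomized algorithm, and its interim rules satisfy $\bar x_i(v)=\mathbb E[x_i(\bar v_i)\mid v_i=v]$ for all $i$ and all $v$; that is, the redraws of the other agents do not affect agent $i$. \item $\mathbb E[v_i\bar x_i(v_i)]\ge\mathbb E[v_ix_i(v_i)]$ for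 every $i$, $\mathrm W(\bar A)\ge \mathrm W(A)$, and $\bar A$ is a Bayesian $\beta$-approximation. \item There are measurable sets $D_i\subseteq[0,\infty)$ of full $F_i$-measure such that each $\bar x_i$ is monotone non-decreasing on $D_i$, and there is a mechanism $M$ whose algorithm has the same outcome distribution as $\bar A$ on every profile $v$ with $v_i\in D_i$ for all $i$, and which on every profile serves with positive probability only sets that $A$ serves with positive probability on some profile. The interim allocation rules $x_i^M$ of $M$ are monotone non-decreasing on all of $[0,\infty)$, its interim payments are $p_i^M(t)=t\,x_i^M(t)-\int_0^t x_i^M(z)\,dz$, it is BIC, $\mathrm W(M)\ge \mathrm W(A)$, and its algorithm is a Bayesian $\beta$-approximation. \end{enumerate} -/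

import Mathlib

open MeasureTheory ProbabilityTheory Set
open scoped NNReal ENNReal

namespace Ironing

/-- Valuation (or bid) profiles of `n` single-parameter agents with values in `[0, ∞)`. -/
abbrev Profile (n : ℕ) : Type := Fin n → ℝ≥0

/-- A randomized algorithm: a (measurable) rule that assigns to every profile a probability
distribution over the sets of agents served; `prob v S` is the probability that exactly the agents
in `S` are served on input `v`. -/
structure Alg (n : ℕ) where
  prob : Profile n → Finset (Fin n) → ℝ
  nonneg : ∀ v S, 0 ≤ prob v S
  sum_eq_one : ∀ v, ∑ S, prob v S = 1
  measurable_prob : ∀ S, Measurable fun v => prob v S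

/-! ### Social welfare and approximation -/

/-- The welfare `∑_{i ∈ S} v_i - c(S)` of serving `S`; it is `-∞` if `c(S) = ∞`. -/
noncomputable def welfareOf {n : ℕ} (c : Finset (Fin n) → EReal) (v : Profile n)
    (S : Finset (Fin n)) : EReal :=
  ((∑ i ∈ S, (v i : ℝ) : ℝ) : EReal) - c S

/-- The maximum social welfare on profile `v`. -/
noncomputable def optAt {n : ℕ} (c : Finset (Fin n) → EReal) (v : Profile n) : EReal :=
  ⨆ S : Finset (Fin n), welfareOf c v S

/-- The expected welfare (over the coins of the algorithm) on profile `v`.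
Recall that `0 * (-∞) = 0` in `EReal`. -/
noncomputable def welfareAt {n : ℕ} (c : Finset (Fin n) → EReal) (A : Alg n) (v : Profile n) :
    EReal :=
  ∑ S : Finset (Fin n), ((A.prob v S : ℝ) : EReal) * welfareOf c v S

/-- Expectation of an extended-real-valued function: `E[f⁺] - E[f⁻]`. -/
noncomputable def extExpect {Ω : Type*} [MeasurableSpace Ω] (P : Measure Ω) (f : Ω → EReal) :
    EReal :=
  ((∫⁻ ω, (f ω).toENNReal ∂P : ℝ≥0∞) : EReal) - ((∫⁻ ω, (-f ω).toENNReal ∂P : ℝ≥0∞) : EReal)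

/-- The optimal expected welfare, for values drawn independently from the `μ i`. -/
noncomputable def opt {n : ℕ} (c : Finset (Fin n) → EReal) (μ : Fin n → Measure ℝ≥0) : EReal :=
  extExpect (Measure.pi μ) (optAt c)

/-- The expected welfare of an algorithm, for values drawn independently from the `μ i`. -/
noncomputable def welfare {n : ℕ} (c : Finset (Fin n) → EReal) (μ : Fin n → Measure ℝ≥0)
    (A : Alg n) : EReal :=
  extExpect (Measure.pi μ) (welfareAt c A)

/-- `A` is a Bayesian `β`-approximation: its expected welfare is at least `OPT / β`. -/
def IsBayesianApprox {n : ℕ} (c : Finset (Fin n) → EReal) (μ : Fin n → Measure ℝ≥0) (β : ℝ)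
    (A : Alg n) : Prop :=
  opt c μ / (β : EReal) ≤ welfare c μ A

/-! ### Interim rules and Bayesian incentive compatibility -/

/-- The probability that agent `i` is served on profile `v`. -/
noncomputable def Alg.serve {n : ℕ} (A : Alg n) (v : Profile n) (i : Fin n) : ℝ :=
  ∑ S : Finset (Fin n), if i ∈ S then A.prob v S else 0

/-- The interim allocation rule `x_i(b)`: the probability that agent `i` is served when bidding `b`,
the other bids being drawn from the prior. -/
noncomputable def Alg.interim {n : ℕ} (A : Alg n) (μ : Fin n → Measure ℝ≥0) (i : Fin n)
    (b : ℝ≥0) : ℝ :=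
  ∫ w, A.serve (Function.update w i b) i ∂(Measure.pi μ)

/-- A mechanism: an algorithm together with a payment rule; `pay v i` is the (expected) payment of
agent `i` on bid profile `v`. -/
structure Mech (n : ℕ) where
  alg : Alg n
  pay : Profile n → Fin n → ℝ

/-- The interim payment `p_i(b)` of agent `i` when bidding `b`. -/
noncomputable def Mech.interimPay {n : ℕ} (M : Mech n) (μ : Fin n → Measure ℝ≥0) (i : Fin n)
    (b : ℝ≥0) : ℝ :=
  ∫ w, M.pay (Function.update w i b) i ∂(Measure.pi μ)

/-- Bayesian incentive compatibility: all interim payments are well defined, and for every agent,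
every value `t` and every bid `b`, bidding `t` is at least as good in expectation as bidding `b`,
the other agents reporting truthfully. -/
def Mech.IsBIC {n : ℕ} (M : Mech n) (μ : Fin n → Measure ℝ≥0) : Prop :=
  ∀ i, (∀ b, Integrable (fun w => M.pay (Function.update w i b) i) (Measure.pi μ)) ∧
    ∀ t b : ℝ≥0, (t : ℝ) * M.alg.interim μ i b - M.interimPay μ i b ≤
      (t : ℝ) * M.alg.interim μ i t - M.interimPay μ i t

/-! ### Ironing in quantile space -/

/-- The distribution function of a prior `ν` on `[0, ∞)`. -/
noncomputable def distr (ν : Measure ℝ≥0) (v : ℝ≥0) : ℝ := ν.real (Iic v)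

/-- The quantile function `F⁻¹(q) = inf {v | q ≤ F(v)}`. -/
noncomputable def quantile (ν : Measure ℝ≥0) (q : ℝ) : ℝ≥0 := sInf {v | q ≤ distr ν v}

/-- The cumulative allocation rule `G(q) = ∫₀^q x(F⁻¹(z)) dz` in quantile space. -/
noncomputable def cumul (ν : Measure ℝ≥0) (x : ℝ≥0 → ℝ) (q : ℝ) : ℝ :=
  ∫ z in (0 : ℝ)..q, x (quantile ν z)

/-- The (lower) convex hull of a function on `[0, 1]`: the pointwise largest convex function on
`[0, 1]` lying below it. -/
noncomputable def convHull (G : ℝ → ℝ) (q : ℝ) : ℝ :=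
  sSup {y | ∃ h : ℝ → ℝ, ConvexOn ℝ (Icc 0 1) h ∧ (∀ t ∈ Icc (0 : ℝ) 1, h t ≤ G t) ∧ y = h q}

/-- The values `v` with `G(F(v)) > Ḡ(F(v))`. -/
def ironSet (ν : Measure ℝ≥0) (x : ℝ≥0 → ℝ) : Set ℝ≥0 :=
  {v | convHull (cumul ν x) (distr ν v) < cumul ν x (distr ν v)}

open Classical in
/-- The law of the bid submitted in place of `v`: if `v` lies in the ironed set, the prior
conditioned on the maximal interval `I ∋ v` contained in that set; otherwise `v` itself. -/
noncomputable def redraw (ν : Measure ℝ≥0) (x : ℝ≥0 → ℝ) (v : ℝ≥0) : Measure ℝ≥0 :=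
  if v ∈ ironSet ν x then ProbabilityTheory.cond ν ((ironSet ν x).ordConnectedComponent v)
  else Measure.dirac v

/-- `B` is the ironed algorithm for `A`: independently for every agent it replaces the bid `v i` by
a draw from `redraw`, for the agent's prior and interim allocation rule under `A`, and then it runs
`A`. -/
def IsIroned {n : ℕ} (μ : Fin n → Measure ℝ≥0) (A B : Alg n) : Prop :=
  ∀ v S, B.prob v S =
    ∫ w, A.prob w S ∂(Measure.pi fun i => redraw (μ i) (A.interim μ i) (v i))

end Ironing

namespace Ironing

/-! ### Integrals against mixtures and products of probability measures -/

/-! Ironing replaces a bid by a fresh draw from its own prior conditioned on an interval containing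
it, so each redraw kernel leaves the prior invariant (`bind_redraw`). The redraws are independent,
hence a prior-distributed profile stays prior-distributed. Two things follow. An agent faces redrawn
rival bids with the same law as before, so its new interim rule is the average of `x` over its own
redraw alone (`Alg.interim_resample`). And each set is served with the same overall probability
(`Alg.integral_prob_resample`), so expected cost is unchanged and only the values served matter
(`welfare_eq_coe`).

What remains concerns one agent, in quantile space. There `G` has derivative `x` almost everywhere
(`ae_hasDerivAt_cumul`). Over a maximal gap between `G` and its hull, the hull is a chord of `G`
(`chord_le_convHull`) and the averaged rule is the slope of that chord; off the gaps `G` touches its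
hull and its tangent supports the hull (`tangent_le_convHull`). The ironed rule is therefore almost
everywhere a subgradient of a convex function, hence monotone. Its cumulative rule lies below `G`
with the same total, so it serves more above every threshold, and a layer-cake formula turns this
into more value (`integral_mul_le_of_setIntegral_Ioi_le`).

Monotonicity holds only off null sets, whereas BIC quantifies over all values and bids. An
exceptional bid is therefore answered by a lottery over feasible sets with the marginal of a
monotone extension; the other agents meet such bids with probability zero
(`Alg.exists_monotone_modification`). Myerson payments then give BIC (`Alg.isBIC_payMech`). -/

theorem integral_bind_of_nonneg {α β : Type*} [MeasurableSpace α] [MeasurableSpace β]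
    {μ : Measure α} [IsProbabilityMeasure μ] {κ : α → Measure β} (hκ : Measurable κ)
    [∀ a, IsProbabilityMeasure (κ a)]
    {f : β → ℝ} (hf : Measurable f) (h0 : ∀ b, 0 ≤ f b) (h1 : ∀ b, f b ≤ 1) :
    ∫ b, f b ∂(μ.bind κ) = ∫ a, ∫ b, f b ∂(κ a) ∂μ := by
  have hm : Measurable fun b => ENNReal.ofReal (f b) := hf.ennreal_ofReal
  have key : ∀ a, ∫ b, f b ∂(κ a) = (∫⁻ b, ENNReal.ofReal (f b) ∂(κ a)).toReal := fun a =>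
    integral_eq_lintegral_of_nonneg_ae (.of_forall h0) hf.aestronglyMeasurable
  have hfin : ∀ a, ∫⁻ b, ENNReal.ofReal (f b) ∂(κ a) < ⊤ := fun a => by
    refine lt_of_le_of_lt (lintegral_mono (g := fun _ => 1) fun b => ?_) (by simp)
    exact ENNReal.ofReal_le_one.2 (h1 b)
  rw [integral_eq_lintegral_of_nonneg_ae (.of_forall h0) hf.aestronglyMeasurable,
    Measure.lintegral_bind hκ.aemeasurable hm.aemeasurable]
  simp_rw [key]
  exact (integral_toReal ((Measure.measurable_lintegral hm).comp hκ).aemeasurable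
    (.of_forall hfin)).symm

/-- The bound by 1 keeps both sides finite, so the product formula for real integrals transfers
through `toReal`. -/
theorem lintegral_pi_prod {ι : Type*} [Fintype ι] {α : Type*} [MeasurableSpace α]
    (μ : ι → Measure α) [∀ i, IsProbabilityMeasure (μ i)] {f : ι → α → ℝ≥0∞}
    (hf : ∀ i, Measurable (f i)) (h1 : ∀ i a, f i a ≤ 1) :
    ∫⁻ v, ∏ i, f i (v i) ∂(Measure.pi μ) = ∏ i, ∫⁻ a, f i a ∂(μ i) := by
  have hle : ∀ i, ∫⁻ a, f i a ∂(μ i) ≤ 1 := fun i =>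
    (lintegral_mono (h1 i)).trans (by simp)
  have hle' : ∀ v : ι → α, ∏ i, f i (v i) ≤ 1 := fun v => Finset.prod_le_one' fun i _ => h1 i _
  have hl : ∫⁻ v, ∏ i, f i (v i) ∂(Measure.pi μ) ≤ 1 := (lintegral_mono hle').trans (by simp)
  have hm : Measurable fun v : ι → α => ∏ i, f i (v i) :=
    Finset.measurable_prod _ fun i _ => (hf i).comp (measurable_pi_apply i)
  have hr : ∏ i, ∫⁻ a, f i a ∂(μ i) ≤ 1 := Finset.prod_le_one' fun i _ => hle i
  rw [← ENNReal.toReal_eq_toReal_iff' (ne_top_of_le_ne_top ENNReal.one_ne_top hl)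
    (ne_top_of_le_ne_top ENNReal.one_ne_top hr), ENNReal.toReal_prod,
    ← integral_toReal hm.aemeasurable
      (.of_forall fun v => (hle' v).trans_lt ENNReal.one_lt_top)]
  simp_rw [ENNReal.toReal_prod]
  rw [integral_fintype_prod_eq_prod (fun i a => (f i a).toReal)]
  exact Finset.prod_congr rfl fun i _ => integral_toReal (hf i).aemeasurable
    (.of_forall fun v => (h1 i v).trans_lt ENNReal.one_lt_top)

theorem measurable_pi_kernel {ι : Type*} [Fintype ι] {α : Type*} [MeasurableSpace α]
    {κ : ι → α → Measure α} (hκ : ∀ i, Measurable (κ i))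
    [hp : ∀ i a, IsProbabilityMeasure (κ i a)] :
    Measurable fun v : ι → α => Measure.pi fun i => κ i (v i) := by
  refine Measurable.measure_of_isPiSystem_of_isProbabilityMeasure generateFrom_pi.symm
    isPiSystem_pi ?_
  rintro _ ⟨s, hs, rfl⟩
  simp_rw [Measure.pi_pi]
  exact Finset.measurable_prod _ fun i _ => (Measure.measurable_coe (hs i (mem_univ i))).comp
    ((hκ i).comp (measurable_pi_apply i))

theorem isProbabilityMeasure_bind {α β : Type*} [MeasurableSpace α] [MeasurableSpace β]
    {μ : Measure α} [IsProbabilityMeasure μ] {κ : α → Measure β} (hκ : Measurable κ)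
    [∀ a, IsProbabilityMeasure (κ a)] : IsProbabilityMeasure (μ.bind κ) :=
  ⟨by rw [Measure.bind_apply .univ hκ.aemeasurable]; simp⟩

/-- A product measure is determined by boxes, and on a box the mixture integrates a product of
functions of one coordinate each. -/
theorem bind_pi_kernel {ι : Type*} [Fintype ι] {α : Type*} [MeasurableSpace α]
    (μ : ι → Measure α) [∀ i, IsProbabilityMeasure (μ i)]
    {κ : ι → α → Measure α} (hκ : ∀ i, Measurable (κ i))
    [hp : ∀ i a, IsProbabilityMeasure (κ i a)] :
    (Measure.pi μ).bind (fun v => Measure.pi fun i => κ i (v i)) =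
      Measure.pi fun i => (μ i).bind (κ i) := by
  have : ∀ i, IsProbabilityMeasure ((μ i).bind (κ i)) := fun i => isProbabilityMeasure_bind (hκ i)
  refine (Measure.pi_eq fun s hs => ?_).symm
  rw [Measure.bind_apply (.univ_pi hs) (measurable_pi_kernel hκ).aemeasurable]
  simp_rw [Measure.pi_pi]
  rw [lintegral_pi_prod μ (f := fun i a => κ i a (s i))
    (fun i => (Measure.measurable_coe (hs i)).comp (hκ i)) fun i a => prob_le_one]
  exact Finset.prod_congr rfl fun i _ => (Measure.bind_apply (hs i) (hκ i).aemeasurable).symm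

theorem isProbabilityMeasure_update {ι : Type*} [DecidableEq ι] {α : Type*} [MeasurableSpace α]
    (μ : ι → Measure α) [∀ i, IsProbabilityMeasure (μ i)] (i : ι) (ρ : Measure α)
    [IsProbabilityMeasure ρ] (j : ι) : IsProbabilityMeasure (Function.update μ i ρ j) := by
  by_cases h : j = i
  · subst h; simpa
  · rw [Function.update_of_ne h]; infer_instance

theorem measurable_update_uncurry {ι : Type*} [DecidableEq ι] {α : Type*} [MeasurableSpace α]
    (i : ι) : Measurable fun p : α × (ι → α) => Function.update p.2 i p.1 := by
  refine measurable_pi_lambda _ fun j => ?_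
  by_cases h : j = i
  · subst h; simpa using measurable_fst
  · simp only [Function.update_of_ne h]
    exact (measurable_pi_apply j).comp measurable_snd

/-- Resampling one coordinate of a product measure. -/
theorem pi_update {ι : Type*} [Fintype ι] [DecidableEq ι] {α : Type*} [MeasurableSpace α]
    (μ : ι → Measure α) [∀ i, IsProbabilityMeasure (μ i)] (i : ι) (ρ : Measure α)
    [IsProbabilityMeasure ρ] :
    Measure.pi (Function.update μ i ρ) =
      (ρ.prod (Measure.pi μ)).map fun p => Function.update p.2 i p.1 := by
  have := isProbabilityMeasure_update μ i ρ
  refine Measure.pi_eq fun s hs => ?_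
  have hpre : (fun p : α × (ι → α) => Function.update p.2 i p.1) ⁻¹' (univ.pi s) =
      s i ×ˢ univ.pi (Function.update s i univ) := by
    ext ⟨t, w⟩
    simp only [mem_preimage, mem_univ_pi, mem_prod]
    constructor
    · refine fun h => ⟨by simpa using h i, fun j => ?_⟩
      by_cases hj : j = i
      · subst hj; simp
      · simpa [hj] using h j
    · rintro ⟨h1, h2⟩ j
      by_cases hj : j = i
      · subst hj; simpa using h1
      · simpa [hj] using h2 j
  rw [Measure.map_apply (measurable_update_uncurry i) (.univ_pi hs), hpre, Measure.prod_prod,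
    Measure.pi_pi, ← Finset.mul_prod_erase _ _ (Finset.mem_univ i),
    ← Finset.mul_prod_erase (a := i) _ (fun j => (Function.update μ i ρ j) (s j))
      (Finset.mem_univ i)]
  simp only [Function.update_self, measure_univ, one_mul]
  congr 1
  refine Finset.prod_congr rfl fun j hj => ?_
  rw [Function.update_of_ne (Finset.ne_of_mem_erase hj),
    Function.update_of_ne (Finset.ne_of_mem_erase hj)]

theorem integral_pi_update {ι : Type*} [Fintype ι] [DecidableEq ι] {α : Type*}
    [MeasurableSpace α] (μ : ι → Measure α) [∀ i, IsProbabilityMeasure (μ i)] (i : ι)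
    (ρ : Measure α) [IsProbabilityMeasure ρ] {f : (ι → α) → ℝ} (hf : Measurable f)
    (hi : Integrable f (Measure.pi (Function.update μ i ρ))) :
    ∫ w, f w ∂(Measure.pi (Function.update μ i ρ)) =
      ∫ t, ∫ w, f (Function.update w i t) ∂(Measure.pi μ) ∂ρ := by
  have hm := measurable_update_uncurry (α := α) i
  rw [pi_update] at hi ⊢
  rw [integral_map hm.aemeasurable hf.aestronglyMeasurable, integral_prod]
  exact (integrable_map_measure hf.aestronglyMeasurable hm.aemeasurable).1 hi

theorem integrable_of_mem_unit {α : Type*} [MeasurableSpace α] {μ : Measure α}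
    [IsFiniteMeasure μ] {f : α → ℝ} (hf : Measurable f) (h0 : ∀ a, 0 ≤ f a)
    (h1 : ∀ a, f a ≤ 1) : Integrable f μ :=
  Integrable.of_bound hf.aestronglyMeasurable 1
    (.of_forall fun a => by rw [Real.norm_of_nonneg (h0 a)]; exact h1 a)

/-! ### Interim rules -/

section Interim

variable {n : ℕ}

theorem Alg.measurable_serve (A : Alg n) (i : Fin n) : Measurable fun v => A.serve v i := by
  unfold Alg.serve
  refine Finset.measurable_sum _ fun S _ => ?_
  split_ifs
  exacts [A.measurable_prob S, measurable_const]

theorem Alg.serve_nonneg (A : Alg n) (v : Profile n) (i : Fin n) : 0 ≤ A.serve v i :=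
  Finset.sum_nonneg fun S _ => by split_ifs; exacts [A.nonneg v S, le_rfl]

theorem Alg.serve_le_one (A : Alg n) (v : Profile n) (i : Fin n) : A.serve v i ≤ 1 := by
  rw [← A.sum_eq_one v]
  exact Finset.sum_le_sum fun S _ => by split_ifs; exacts [le_rfl, A.nonneg v S]

theorem Alg.prob_le_one (A : Alg n) (v : Profile n) (S : Finset (Fin n)) : A.prob v S ≤ 1 := by
  rw [← A.sum_eq_one v]
  exact Finset.single_le_sum (fun T _ => A.nonneg v T) (Finset.mem_univ S)

theorem Alg.integrable_prob (A : Alg n) (S : Finset (Fin n)) (P : Measure (Profile n))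
    [IsFiniteMeasure P] : Integrable (fun v => A.prob v S) P :=
  integrable_of_mem_unit (A.measurable_prob S) (fun v => A.nonneg v S) fun v => A.prob_le_one v S

variable (μ : Fin n → Measure ℝ≥0)

theorem Alg.interim_nonneg (A : Alg n) (i : Fin n) (b : ℝ≥0) : 0 ≤ A.interim μ i b :=
  integral_nonneg fun _ => A.serve_nonneg _ i

variable [∀ i, IsProbabilityMeasure (μ i)]

theorem Alg.interim_le_one (A : Alg n) (i : Fin n) (b : ℝ≥0) : A.interim μ i b ≤ 1 := by
  refine (integral_mono_of_nonneg (.of_forall fun _ => A.serve_nonneg _ i)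
    (integrable_const (1 : ℝ)) (.of_forall fun _ => A.serve_le_one _ i)).trans ?_
  simp

theorem Alg.measurable_interim (A : Alg n) (i : Fin n) : Measurable (A.interim μ i) := by
  have : StronglyMeasurable fun p : ℝ≥0 × Profile n => A.serve (Function.update p.2 i p.1) i :=
    ((A.measurable_serve i).comp (measurable_update_uncurry i)).stronglyMeasurable
  exact (this.integral_prod_right (ν := Measure.pi μ)).measurable

theorem Alg.integral_serve_update (A : Alg n) (i : Fin n) (ρ : Measure ℝ≥0)
    [IsProbabilityMeasure ρ] :
    ∫ w, A.serve w i ∂(Measure.pi (Function.update μ i ρ)) = ∫ t, A.interim μ i t ∂ρ := by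
  have := isProbabilityMeasure_update μ i ρ
  exact integral_pi_update μ i ρ (A.measurable_serve i)
    (integrable_of_mem_unit (A.measurable_serve i) (A.serve_nonneg · i) (A.serve_le_one · i))

theorem Alg.integral_mul_serve (A : Alg n) (i : Fin n)
    (hμ : Integrable (fun v : ℝ≥0 => (v : ℝ)) (μ i)) :
    ∫ w, (w i : ℝ) * A.serve w i ∂(Measure.pi μ) = ∫ t, (t : ℝ) * A.interim μ i t ∂(μ i) := by
  have hm : Measurable fun w : Profile n => (w i : ℝ) * A.serve w i :=
    ((measurable_pi_apply i).coe_nnreal_real).mul (A.measurable_serve i)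
  have h := integral_pi_update μ i (μ i) hm
  rw [Function.update_eq_self] at h
  rw [h]
  · simp only [Function.update_self, integral_const_mul]
    rfl
  · refine (integrable_comp_eval (i := i) hμ).mul_of_top_left (memLp_top_of_bound
      (A.measurable_serve i).aestronglyMeasurable 1 (.of_forall fun v => ?_))
    rw [Real.norm_of_nonneg (A.serve_nonneg _ i)]; exact A.serve_le_one _ i

variable {μ}

/-- The algorithm that resamples each bid from a kernel and then runs `A`. -/
noncomputable def Alg.resample (A : Alg n) (κ : Fin n → ℝ≥0 → Measure ℝ≥0)
    (hκ : ∀ i, Measurable (κ i)) (hp : ∀ i a, IsProbabilityMeasure (κ i a)) : Alg n where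
  prob v S := ∫ w, A.prob w S ∂(Measure.pi fun i => κ i (v i))
  nonneg v S := integral_nonneg fun w => A.nonneg w S
  sum_eq_one v := by
    rw [← integral_finsetSum _ fun S _ => A.integrable_prob S _]
    simp [A.sum_eq_one]
  measurable_prob S :=
    (StronglyMeasurable.integral_kernel (κ := ⟨_, measurable_pi_kernel hκ⟩)
      (A.measurable_prob S).stronglyMeasurable).measurable

variable {A : Alg n} {κ : Fin n → ℝ≥0 → Measure ℝ≥0}
  {hκ : ∀ i, Measurable (κ i)} {hp : ∀ i a, IsProbabilityMeasure (κ i a)}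

theorem Alg.serve_resample (v : Profile n) (i : Fin n) :
    (A.resample κ hκ hp).serve v i = ∫ w, A.serve w i ∂(Measure.pi fun i => κ i (v i)) := by
  unfold Alg.serve
  rw [integral_finsetSum]
  · refine Finset.sum_congr rfl fun S _ => ?_
    split_ifs
    · rfl
    · simp
  · intro S _
    split_ifs
    exacts [A.integrable_prob S _, integrable_zero _ _ _]

/-- If the kernels preserve the priors, then the resampling of the other bids is invisible. -/
theorem Alg.interim_resample (hinv : ∀ i, (μ i).bind (κ i) = μ i) (i : Fin n) (b : ℝ≥0) :
    (A.resample κ hκ hp).interim μ i b = ∫ w, A.interim μ i w ∂(κ i b) := by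
  have hprob := isProbabilityMeasure_update μ i (Measure.dirac b)
  -- Bidding `b` amounts to drawing the bid from the Dirac mass at `b`. The whole profile then has a
  -- product law, and mixing over the kernels fixes every factor except the `i`-th, which becomes `κ
  -- i b`.
  have h1 : (A.resample κ hκ hp).interim μ i b =
      ∫ u, (A.resample κ hκ hp).serve u i ∂(Measure.pi (Function.update μ i (.dirac b))) := by
    rw [Alg.integral_serve_update, integral_dirac' _ _
      ((A.resample κ hκ hp).measurable_interim μ i).stronglyMeasurable]
  have hb : (fun j => (Function.update μ i (.dirac b) j).bind (κ j)) =
      Function.update μ i (κ i b) := by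
    funext j
    by_cases h : j = i
    · subst h; simp [Measure.dirac_bind (hκ j)]
    · simp [h, hinv]
  rw [h1]
  simp_rw [Alg.serve_resample]
  rw [← integral_bind_of_nonneg (measurable_pi_kernel hκ) (A.measurable_serve i)
    (A.serve_nonneg · i) (A.serve_le_one · i), bind_pi_kernel _ hκ, hb,
    Alg.integral_serve_update]

/-- This is why ironing leaves the expected cost unchanged, for an arbitrary cost function. -/
theorem Alg.integral_prob_resample (hinv : ∀ i, (μ i).bind (κ i) = μ i) (S : Finset (Fin n)) :
    ∫ v, (A.resample κ hκ hp).prob v S ∂(Measure.pi μ) = ∫ v, A.prob v S ∂(Measure.pi μ) := by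
  change ∫ v, ∫ w, A.prob w S ∂(Measure.pi fun i => κ i (v i)) ∂(Measure.pi μ) = _
  rw [← integral_bind_of_nonneg (measurable_pi_kernel hκ) (A.measurable_prob S)
    (A.nonneg · S) (A.prob_le_one · S), bind_pi_kernel _ hκ]
  simp_rw [hinv]

theorem Alg.exists_prob_pos_of_resample {v : Profile n} {S : Finset (Fin n)}
    (h : 0 < (A.resample κ hκ hp).prob v S) : ∃ w, 0 < A.prob w S := by
  by_contra! hn
  exact absurd h (not_lt.2 (integral_nonpos hn))

end Interim

/-! ### Distribution and quantile functions of atomless priors -/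

section Quantile

variable (ν : Measure ℝ≥0) [IsProbabilityMeasure ν]

theorem distr_mono : Monotone (distr ν) := fun _ _ h => measureReal_mono (Iic_subset_Iic.2 h)

theorem distr_mem_Icc (v : ℝ≥0) : distr ν v ∈ Icc (0 : ℝ) 1 :=
  ⟨measureReal_nonneg, measureReal_le_one⟩

theorem tendsto_distr_atTop : Filter.Tendsto (distr ν) Filter.atTop (nhds 1) := by
  have h := (ENNReal.tendsto_toReal (measure_ne_top ν univ)).comp (tendsto_measure_Iic_atTop ν)
  simp only [measure_univ, ENNReal.toReal_one] at h
  exact h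

variable [NullSingletonClass ν]

omit [IsProbabilityMeasure ν] in
theorem distr_zero : distr ν 0 = 0 := by
  have : Iic (0 : ℝ≥0) = {0} := by ext; simp
  simp [distr, this, Measure.real]

/-- The indicator of `w ≤ v`, as a function of `v`, jumps only at `v = w`. Without atoms almost no
`w` jumps at a given `v`, and dominated convergence applies. -/
theorem continuous_distr : Continuous (distr ν) := by
  have h : distr ν = fun v => ∫ w, (Iic v).indicator (fun _ => (1 : ℝ)) w ∂ν := by
    funext v
    rw [integral_indicator measurableSet_Iic]
    simp [distr]
  rw [continuous_iff_continuousAt, h]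
  intro v
  refine continuousAt_of_dominated (bound := fun _ => 1) (.of_forall fun u => ?_)
    (.of_forall fun u => .of_forall fun w => ?_) (integrable_const _) ?_
  · exact (measurable_const.indicator measurableSet_Iic).aestronglyMeasurable
  · by_cases hw : w ∈ Iic u <;> simp [hw]
  · have hne : ∀ᵐ w ∂ν, w ≠ v := by simp [ae_iff, measure_singleton]
    filter_upwards [hne] with w hw
    rcases lt_or_gt_of_ne hw with hw | hw
    · refine (continuousAt_const (y := (1 : ℝ))).congr ?_
      filter_upwards [eventually_gt_nhds hw] with u hu
      simp [hu.le]
    · refine (continuousAt_const (y := (0 : ℝ))).congr ?_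
      filter_upwards [eventually_lt_nhds hw] with u hu
      simp [hu]

theorem exists_distr_eq {z : ℝ} (hz : z ∈ Ioo (0 : ℝ) 1) : ∃ v, distr ν v = z := by
  obtain ⟨v, hv⟩ := ((tendsto_distr_atTop ν).eventually (eventually_ge_nhds hz.2)).exists
  exact mem_range_of_exists_le_of_exists_ge (continuous_distr ν)
    ⟨0, (distr_zero ν).trans_le hz.1.le⟩ ⟨v, hv⟩

/-- The open interval matters: if `F` never reaches 1, the set defining the quantile of 1 is empty
and its infimum is 0 by default. -/
theorem distr_quantile {z : ℝ} (hz : z ∈ Ioo (0 : ℝ) 1) : distr ν (quantile ν z) = z := by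
  obtain ⟨v, hv⟩ := exists_distr_eq ν hz
  have hcl : IsClosed {v | z ≤ distr ν v} := isClosed_le continuous_const (continuous_distr ν)
  refine le_antisymm ?_ (hcl.csInf_mem ⟨v, hv.ge⟩ (OrderBot.bddBelow _))
  rw [← hv]
  exact distr_mono ν (csInf_le (OrderBot.bddBelow _) (le_refl (distr ν v)))

theorem quantile_le_iff {z : ℝ} (hz : z ∈ Ioo (0 : ℝ) 1) {v : ℝ≥0} :
    quantile ν z ≤ v ↔ z ≤ distr ν v :=
  ⟨fun h => (distr_quantile ν hz).ge.trans (distr_mono ν h),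
    fun h => csInf_le (OrderBot.bddBelow _) h⟩

theorem aemeasurable_quantile : AEMeasurable (quantile ν) (volume.restrict (Ioo 0 1)) := by
  refine aemeasurable_restrict_of_monotoneOn measurableSet_Ioo fun a ha b hb hab => ?_
  rw [quantile_le_iff ν ha, distr_quantile ν hb]
  exact hab

/-- The quantile function transports the uniform distribution to the prior. -/
theorem map_quantile : (volume.restrict (Ioo (0 : ℝ) 1)).map (quantile ν) = ν := by
  have hfin : IsFiniteMeasure (volume.restrict (Ioo (0 : ℝ) 1)) := ⟨by simp⟩
  refine Measure.ext_of_Iic _ _ fun v => ?_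
  have hF := distr_mem_Icc ν v
  have : ENNReal.ofReal (distr ν v) = ν (Iic v) := ENNReal.ofReal_toReal (measure_ne_top _ _)
  rw [Measure.map_apply_of_aemeasurable (aemeasurable_quantile ν) measurableSet_Iic, ← this,
    Measure.restrict_apply' measurableSet_Ioo]
  have hset : quantile ν ⁻¹' Iic v ∩ Ioo 0 1 = Iic (distr ν v) ∩ Ioo 0 1 := by
    ext z
    simp only [mem_inter_iff, mem_preimage, mem_Iic, and_congr_left_iff]
    exact fun hz => quantile_le_iff ν hz
  have hae : (Iic (distr ν v) ∩ Ioo 0 1 : Set ℝ) =ᵐ[volume] Ioc 0 (distr ν v) := by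
    have h1 : ∀ᵐ z : ℝ, z ≠ 1 := by simp [ae_iff, measure_singleton]
    filter_upwards [h1] with z hz
    have := hF.2
    refine propext ⟨fun h => ⟨h.2.1, h.1⟩, fun h => ⟨h.2, h.1, lt_of_le_of_ne ?_ hz⟩⟩
    exact h.2.trans this
  rw [hset, measure_congr hae]
  simp

theorem quantile_preimage_distr_preimage (s : Set ℝ) :
    quantile ν ⁻¹' (distr ν ⁻¹' s) ∩ Ioo 0 1 = s ∩ Ioo 0 1 := by
  ext z
  simp only [mem_inter_iff, mem_preimage, and_congr_left_iff]
  exact fun hz => by rw [distr_quantile ν hz]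

/-- The quantile function carries the uniform law to the prior and `F` inverts it, so `F(v)` is
uniform on the unit interval. -/
theorem measure_distr_preimage {s : Set ℝ} (hs : MeasurableSet s) :
    ν (distr ν ⁻¹' s) = volume (s ∩ Ioo 0 1) := by
  have hm := hs.preimage (distr_mono ν).measurable
  have h := Measure.map_apply_of_aemeasurable (aemeasurable_quantile ν) hm
  rwa [map_quantile ν, Measure.restrict_apply' measurableSet_Ioo,
    quantile_preimage_distr_preimage] at h

theorem setIntegral_distr_preimage {x : ℝ≥0 → ℝ} (hx : Measurable x) {s : Set ℝ}
    (hs : MeasurableSet s) :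
    ∫ v in distr ν ⁻¹' s, x v ∂ν = ∫ z in s ∩ Ioo 0 1, x (quantile ν z) := by
  have hm := hs.preimage (distr_mono ν).measurable
  have h := setIntegral_map (μ := volume.restrict (Ioo (0 : ℝ) 1)) hm (f := x)
    hx.aestronglyMeasurable (aemeasurable_quantile ν)
  rw [map_quantile] at h
  rw [h, Measure.restrict_restrict₀', quantile_preimage_distr_preimage]
  exact measurableSet_Ioo.nullMeasurableSet

theorem ae_distr_mem_Ioo : ∀ᵐ v ∂ν, distr ν v ∈ Ioo (0 : ℝ) 1 := by
  have h := measure_distr_preimage ν (s := (Ioo (0 : ℝ) 1)ᶜ) measurableSet_Ioo.compl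
  rw [compl_inter_self, measure_empty] at h
  exact h

/-- The sets are nested and differ only by a flat stretch of `F` after `t`, which carries no mass.
-/
theorem Iic_ae_eq_distr_preimage (t : ℝ≥0) : Iic t =ᵐ[ν] distr ν ⁻¹' Iic (distr ν t) := by
  refine ae_eq_of_subset_of_measure_ge (fun v hv => distr_mono ν hv) ?_
    measurableSet_Iic.nullMeasurableSet (measure_ne_top _ _)
  have hF := distr_mem_Icc ν t
  rw [measure_distr_preimage ν measurableSet_Iic,
    ← ENNReal.ofReal_toReal (measure_ne_top ν (Iic t))]
  refine (measure_mono (t := Ioc 0 (distr ν t)) fun z hz => ⟨hz.2.1, hz.1⟩).trans ?_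
  simp [distr, Measure.real]

/-- A flat stretch of `F` ending at `v` contains a point of a countable dense set, so `v` lies in
one of countably many level sets of `F`, each of them null. -/
theorem ae_distr_lt : ∀ᵐ v ∂ν, ∀ u < v, distr ν u < distr ν v := by
  obtain ⟨s, hs, hd⟩ := TopologicalSpace.exists_countable_dense ℝ≥0
  have hnull : ∀ r ∈ s, ∀ᵐ v ∂ν, distr ν v ≠ distr ν r := fun r _ => by
    have h := measure_distr_preimage ν (measurableSet_singleton (distr ν r))
    rw [measure_mono_null inter_subset_left (by simp)] at h
    rw [ae_iff]
    simpa only [not_not] using! h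
  filter_upwards [(ae_ball_iff hs).2 hnull] with v hv u huv
  refine lt_of_le_of_ne (distr_mono ν huv.le) fun he => ?_
  obtain ⟨r, hr, hur, hrv⟩ := hd.exists_between huv
  exact hv r hr (le_antisymm (he ▸ distr_mono ν hur.le) (distr_mono ν hrv.le))

omit [IsProbabilityMeasure ν] [NullSingletonClass ν] in
theorem quantile_distr {v : ℝ≥0} (hv : ∀ u < v, distr ν u < distr ν v) :
    quantile ν (distr ν v) = v :=
  IsLeast.csInf_eq ⟨le_refl (distr ν v), fun u (hu : distr ν v ≤ distr ν u) =>
    not_lt.1 fun h => (hv u h).not_ge hu⟩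

end Quantile

/-! ### The convex hull of a function on the unit interval -/

section Hull

variable {G : ℝ → ℝ}

theorem convHull_le (h0 : ∀ t ∈ Icc (0 : ℝ) 1, 0 ≤ G t) {q : ℝ} (hq : q ∈ Icc (0 : ℝ) 1) :
    convHull G q ≤ G q := by
  refine csSup_le ⟨0, fun _ => 0, convexOn_const 0 (convex_Icc 0 1), h0, rfl⟩ ?_
  rintro _ ⟨h, -, hle, rfl⟩
  exact hle q hq

theorem le_convHull {h : ℝ → ℝ} (hc : ConvexOn ℝ (Icc 0 1) h)
    (hle : ∀ t ∈ Icc (0 : ℝ) 1, h t ≤ G t) {q : ℝ} (hq : q ∈ Icc (0 : ℝ) 1) :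
    h q ≤ convHull G q := by
  refine le_csSup ⟨G q, ?_⟩ ⟨h, hc, hle, rfl⟩
  rintro _ ⟨k, -, hk, rfl⟩
  exact hk q hq

theorem convexOn_affine (s : Set ℝ) (hs : Convex ℝ s) (a m b : ℝ) :
    ConvexOn ℝ s fun t => a + m * (t - b) :=
  ⟨hs, fun x _ y _ p q _ _ hpq => le_of_eq (by
    obtain rfl : p = 1 - q := by linarith
    simp only [smul_eq_mul]; ring)⟩

theorem affine_le_convHull {a m b : ℝ} (hle : ∀ t ∈ Icc (0 : ℝ) 1, a + m * (t - b) ≤ G t) {q : ℝ}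
    (hq : q ∈ Icc (0 : ℝ) 1) : a + m * (q - b) ≤ convHull G q :=
  le_convHull (convexOn_affine _ (convex_Icc 0 1) a m b) hle hq

theorem convexOn_convHull (h0 : ∀ t ∈ Icc (0 : ℝ) 1, 0 ≤ G t) :
    ConvexOn ℝ (Icc 0 1) (convHull G) := by
  refine ⟨convex_Icc 0 1, fun s hs t ht a b ha hb hab => ?_⟩
  refine csSup_le ⟨0, fun _ => 0, convexOn_const 0 (convex_Icc 0 1), h0, rfl⟩ ?_
  rintro _ ⟨h, hc, hle, rfl⟩
  refine (hc.2 hs ht ha hb hab).trans ?_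
  simp only [smul_eq_mul]
  gcongr
  exacts [le_convHull hc hle hs, le_convHull hc hle ht]

/-- The quantiles at which a function lies strictly above its convex hull. -/
def gapSet (G : ℝ → ℝ) : Set ℝ := {q | q ∈ Icc (0 : ℝ) 1 ∧ convHull G q < G q}

variable (h0 : ∀ t ∈ Icc (0 : ℝ) 1, 0 ≤ G t) (hG0 : G 0 = 0)
  (h1 : ∀ t ∈ Icc (0 : ℝ) 1, G 1 + 1 * (t - 1) ≤ G t)

include h0 in
theorem convHull_eq_of_notMem {q : ℝ} (hq : q ∈ Icc (0 : ℝ) 1) (h : q ∉ gapSet G) :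
    convHull G q = G q :=
  le_antisymm (convHull_le h0 hq) (not_lt.1 fun hlt => h ⟨hq, hlt⟩)

include h0 hG0 in
theorem zero_notMem_gapSet : (0 : ℝ) ∉ gapSet G := fun h => by
  have := le_convHull (convexOn_const (0 : ℝ) (convex_Icc 0 1)) h0 h.1
  have := h.2
  linarith

include h1 in
-- By `h1` the line of slope 1 through `(1, G 1)` is an affine minorant, and it meets `G` at 1.
theorem one_notMem_gapSet : (1 : ℝ) ∉ gapSet G := fun h => by
  have := affine_le_convHull h1 h.1
  have := h.2
  linarith

include h0 hG0 h1 in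
-- A convex function is continuous in the interior of its domain. It may jump at the endpoints,
-- which is why these are excluded separately.
theorem isOpen_gapSet (hc : ContinuousOn G (Icc 0 1)) : IsOpen (gapSet G) := by
  have heq : gapSet G = Ioo 0 1 ∩ (fun q => G q - convHull G q) ⁻¹' Ioi 0 := by
    ext q
    simp only [gapSet, mem_inter_iff, mem_preimage, mem_Ioi, sub_pos]
    constructor
    · intro h
      refine ⟨⟨lt_of_le_of_ne h.1.1 ?_, lt_of_le_of_ne h.1.2 ?_⟩, h.2⟩
      · rintro rfl; exact zero_notMem_gapSet h0 hG0 h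
      · rintro rfl; exact one_notMem_gapSet h1 h
    · exact fun h => ⟨Ioo_subset_Icc_self h.1, h.2⟩
  rw [heq]
  refine ContinuousOn.isOpen_inter_preimage ?_ isOpen_Ioo isOpen_Ioi
  exact (hc.mono Ioo_subset_Icc_self).sub (((convexOn_convHull h0).subset Ioo_subset_Icc_self
    (convex_Ioo 0 1)).continuousOn isOpen_Ioo)

include h0 hG0 h1 in
theorem exists_Ioo_subset_gapSet (hc : ContinuousOn G (Icc 0 1)) {q : ℝ} (hq : q ∈ gapSet G) :
    ∃ α β, α ∈ Icc (0 : ℝ) 1 ∧ β ∈ Icc (0 : ℝ) 1 ∧ α ∉ gapSet G ∧ β ∉ gapSet G ∧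
      q ∈ Ioo α β ∧ Ioo α β ⊆ gapSet G := by
  have ho := isOpen_gapSet h0 hG0 h1 hc
  have hK : IsCompact (Icc (0 : ℝ) 1 \ gapSet G) := isCompact_Icc.diff ho
  -- `α` is the last quantile outside the gap to the left of `q`, and `β` the first one to the
  -- right.
  obtain ⟨α, hα, hα'⟩ := (hK.inter_right (isClosed_Iic (a := q))).exists_isGreatest
    ⟨0, ⟨by simp, zero_notMem_gapSet h0 hG0⟩, hq.1.1⟩
  obtain ⟨β, hβ, hβ'⟩ := (hK.inter_right (isClosed_Ici (a := q))).exists_isLeast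
    ⟨1, ⟨by simp, one_notMem_gapSet h1⟩, hq.1.2⟩
  refine ⟨α, β, hα.1.1, hβ.1.1, hα.1.2, hβ.1.2, ⟨lt_of_le_of_ne hα.2 ?_, lt_of_le_of_ne hβ.2 ?_⟩,
    fun z hz => ?_⟩
  · rintro rfl; exact hα.1.2 hq
  · rintro rfl; exact hβ.1.2 hq
  · have hz01 : z ∈ Icc (0 : ℝ) 1 := ⟨hα.1.1.1.trans hz.1.le, hz.2.le.trans hβ.1.1.2⟩
    by_contra hn
    rcases le_total z q with h | h
    · exact (hα' ⟨⟨hz01, hn⟩, h⟩).not_gt hz.1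
    · exact (hβ' ⟨⟨hz01, hn⟩, h⟩).not_gt hz.2

include h0 in
/-- On a maximal interval on which a function exceeds its hull, the chord supports the hull. -/
theorem chord_le_convHull (hc : ContinuousOn G (Icc 0 1)) {α β : ℝ} (hα : α ∈ Icc (0 : ℝ) 1)
    (hβ : β ∈ Icc (0 : ℝ) 1) (hαβ : α < β) (hα' : α ∉ gapSet G) (hβ' : β ∉ gapSet G)
    (hsub : Ioo α β ⊆ gapSet G) {t : ℝ} (ht : t ∈ Icc (0 : ℝ) 1) :
    G α + (G β - G α) / (β - α) * (t - α) ≤ convHull G t := by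
  set m := (G β - G α) / (β - α) with hm
  have hmul : m * (β - α) = G β - G α := div_mul_cancel₀ _ (sub_pos.2 hαβ).ne'
  have hHα := convHull_eq_of_notMem h0 hα hα'
  have hHβ := convHull_eq_of_notMem h0 hβ hβ'
  have hconv := convexOn_convHull h0
  -- Outside the interval convexity of the hull suffices, since the hull meets `G` at `α` and at
  -- `β`.
  have hout : ∀ t ∈ Icc (0 : ℝ) 1, t ∉ Ioo α β → G α + m * (t - α) ≤ convHull G t := by
    intro t ht hn
    rcases le_or_gt t α with h | h
    · rcases h.eq_or_lt with rfl | h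
      · simp [hHα]
      · have := hconv.slope_mono_adjacent ht hβ h hαβ
        rw [hHβ, hHα, ← hm, div_le_iff₀ (sub_pos.2 h)] at this
        linarith
    · have h' : β ≤ t := not_lt.1 fun h' => hn ⟨h, h'⟩
      rcases h'.eq_or_lt with rfl | h'
      · rw [hHβ]; linarith
      · have := hconv.slope_mono_adjacent hα ht hαβ h'
        rw [hHβ, hHα, ← hm, le_div_iff₀ (sub_pos.2 h')] at this
        linarith
  have hIcc : Icc α β ⊆ Icc (0 : ℝ) 1 := Icc_subset_Icc hα.1 hβ.2
  -- If `G` dipped below the chord, the minimum of the difference would be negative and attained at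
  -- an interior `p`. The chord lowered to pass through `(p, G p)` would be an affine minorant of
  -- `G` on the unit interval, so the hull would reach `G p` although `p` lies in the gap.
  obtain ⟨p, hp, hmin⟩ := isCompact_Icc.exists_isMinOn (nonempty_Icc.2 hαβ.le)
    (f := fun t => G t - (G α + m * (t - α))) ((hc.mono hIcc).sub (by fun_prop))
  have hin : ∀ t ∈ Icc α β, G α + m * (t - α) ≤ G t := by
    by_contra! hneg
    obtain ⟨u, hu, hlt⟩ := hneg
    have hmu : G p - (G α + m * (p - α)) ≤ G u - (G α + m * (u - α)) := hmin hu
    have hpI : p ∈ Ioo α β := by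
      refine ⟨lt_of_le_of_ne hp.1 ?_, lt_of_le_of_ne hp.2 ?_⟩
      · rintro rfl; simp only [sub_self, mul_zero, add_zero] at hmu; linarith
      · rintro rfl; linarith
    have := affine_le_convHull (G := G) (a := G α + (G p - (G α + m * (p - α)))) (m := m) (b := α)
      (fun t ht => ?_) (hIcc hp)
    · have := (hsub hpI).2
      linarith
    · by_cases htI : t ∈ Ioo α β
      · have : G p - (G α + m * (p - α)) ≤ G t - (G α + m * (t - α)) :=
          hmin (Ioo_subset_Icc_self htI)
        linarith
      · have := hout t ht htI
        have := convHull_le h0 ht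
        linarith
  refine affine_le_convHull (fun t ht => ?_) ht
  by_cases htI : t ∈ Ioo α β
  · exact hin t (Ioo_subset_Icc_self htI)
  · exact (hout t ht htI).trans (convHull_le h0 ht)

include h0 in
/-- Where a differentiable function touches its hull, the tangent supports the hull. -/
theorem tangent_le_convHull {q m : ℝ} (hq : q ∈ Ioo (0 : ℝ) 1) (hq' : q ∉ gapSet G)
    (hd : HasDerivAt G m q) {t : ℝ} (ht : t ∈ Icc (0 : ℝ) 1) :
    G q + m * (t - q) ≤ convHull G t := by
  have hqI := Ioo_subset_Icc_self hq
  have hH := convHull_eq_of_notMem h0 hqI hq'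
  have hconv := convexOn_convHull h0
  have hs := hasDerivAt_iff_tendsto_slope_left_right.1 hd
  rcases lt_trichotomy t q with h | rfl | h
  · have hle : (convHull G q - convHull G t) / (q - t) ≤ m := by
      -- For `z > q` the slope of the hull from `t` to `q` is at most its slope from `q` to `z`. The
      -- latter is at most that of `G`, because the hull equals `G` at `q` and lies below it at `z`.
      refine ge_of_tendsto hs.2 ?_
      filter_upwards [Ioo_mem_nhdsGT hq.2] with z hz
      have hzI : z ∈ Icc (0 : ℝ) 1 := ⟨hqI.1.trans hz.1.le, hz.2.le⟩
      refine (hconv.slope_mono_adjacent ht hzI h hz.1).trans ?_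
      rw [slope_def_field, hH]
      have := sub_pos.2 hz.1
      gcongr
      exact convHull_le h0 hzI
    rw [div_le_iff₀ (sub_pos.2 h), hH] at hle
    linarith
  · simp [hH]
  · have hle : m ≤ (convHull G t - convHull G q) / (t - q) := by
      refine le_of_tendsto hs.1 ?_
      filter_upwards [Ioo_mem_nhdsLT hq.1] with z hz
      have hzI : z ∈ Icc (0 : ℝ) 1 := ⟨hz.1.le, hz.2.le.trans hqI.2⟩
      refine le_trans ?_ (hconv.slope_mono_adjacent hzI ht hz.2 h)
      rw [slope_comm, slope_def_field, hH]
      have := sub_pos.2 hz.2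
      gcongr
      exact convHull_le h0 hzI
    rw [le_div_iff₀ (sub_pos.2 h), hH] at hle
    linarith

end Hull

/-! ### The cumulative allocation rule -/

section Cumul

variable (ν : Measure ℝ≥0) [IsProbabilityMeasure ν] [NullSingletonClass ν] {x : ℝ≥0 → ℝ}
  (hx : Measurable x) (hx0 : ∀ v, 0 ≤ x v) (hx1 : ∀ v, x v ≤ 1)

include hx hx0 hx1 in
theorem intervalIntegrable_quantile {a b : ℝ} (ha : a ∈ Icc (0 : ℝ) 1) (hb : b ∈ Icc (0 : ℝ) 1) :
    IntervalIntegrable (fun z => x (quantile ν z)) volume a b := by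
  have h : IntegrableOn (fun z => x (quantile ν z)) (Ioo 0 1) := by
    refine Integrable.of_bound ((hx.comp_aemeasurable
      (aemeasurable_quantile ν)).aestronglyMeasurable) 1 (.of_forall fun z => ?_)
    rw [Real.norm_of_nonneg (hx0 _)]
    exact hx1 _
  have h' : IntervalIntegrable (fun z => x (quantile ν z)) volume 0 1 :=
    (intervalIntegrable_iff_integrableOn_Ioo_of_le zero_le_one).2 h
  refine h'.mono_set ?_
  rw [uIcc_of_le zero_le_one]
  exact uIcc_subset_Icc ha hb

include hx hx0 hx1 in
theorem cumul_sub_cumul {α β : ℝ} (hα : α ∈ Icc (0 : ℝ) 1) (hβ : β ∈ Icc (0 : ℝ) 1) (h : α ≤ β) :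
    cumul ν x β - cumul ν x α = ∫ z in Ioo α β, x (quantile ν z) := by
  have h0 : (0 : ℝ) ∈ Icc (0 : ℝ) 1 := by simp
  unfold cumul
  rw [intervalIntegral.integral_interval_sub_left (intervalIntegrable_quantile ν hx hx0 hx1 h0 hβ)
    (intervalIntegrable_quantile ν hx hx0 hx1 h0 hα), intervalIntegral.integral_of_le h,
    integral_Ioc_eq_integral_Ioo]

include hx hx0 hx1 in
theorem setIntegral_distr_Ioo {α β : ℝ} (hα : α ∈ Icc (0 : ℝ) 1) (hβ : β ∈ Icc (0 : ℝ) 1)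
    (h : α ≤ β) :
    ∫ v in distr ν ⁻¹' Ioo α β, x v ∂ν = cumul ν x β - cumul ν x α := by
  rw [setIntegral_distr_preimage ν hx measurableSet_Ioo, cumul_sub_cumul ν hx hx0 hx1 hα hβ h,
    inter_eq_left.2 (Ioo_subset_Ioo hα.1 hβ.2)]

theorem measureReal_distr_Ioo {α β : ℝ} (hα : α ∈ Icc (0 : ℝ) 1) (hβ : β ∈ Icc (0 : ℝ) 1)
    (h : α ≤ β) : ν.real (distr ν ⁻¹' Ioo α β) = β - α := by
  rw [Measure.real, measure_distr_preimage ν measurableSet_Ioo,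
    inter_eq_left.2 (Ioo_subset_Ioo hα.1 hβ.2), Real.volume_Ioo,
    ENNReal.toReal_ofReal (sub_nonneg.2 h)]

theorem distr_preimage_Iic_ae_eq (q : ℝ) : distr ν ⁻¹' Iic q =ᵐ[ν] distr ν ⁻¹' Ioo 0 q := by
  have hq : ∀ᵐ v ∂ν, distr ν v ≠ q := by
    have h := measure_distr_preimage ν (measurableSet_singleton q)
    rw [measure_mono_null inter_subset_left (by simp)] at h
    rw [ae_iff]
    simpa only [not_not] using! h
  filter_upwards [ae_distr_mem_Ioo ν, hq] with v h1 h2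
  exact propext ⟨fun h => ⟨h1.1, lt_of_le_of_ne h h2⟩, fun h => h.2.le⟩

omit [IsProbabilityMeasure ν] [NullSingletonClass ν] in
theorem cumul_zero : cumul ν x 0 = 0 := by simp [cumul]

include hx hx0 hx1 in
theorem setIntegral_distr_Iic {q : ℝ} (hq : q ∈ Icc (0 : ℝ) 1) :
    ∫ v in distr ν ⁻¹' Iic q, x v ∂ν = cumul ν x q := by
  rw [setIntegral_congr_set (distr_preimage_Iic_ae_eq ν q),
    setIntegral_distr_Ioo ν hx hx0 hx1 (by simp) hq hq.1, cumul_zero, sub_zero]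

include hx0 in
omit [IsProbabilityMeasure ν] [NullSingletonClass ν] in
theorem cumul_nonneg (q : ℝ) (hq : q ∈ Icc (0 : ℝ) 1) : 0 ≤ cumul ν x q :=
  intervalIntegral.integral_nonneg hq.1 fun _ _ => hx0 _

include hx hx0 hx1 in
-- Since `x ≤ 1`, `G` grows with slope at most 1. This is the affine minorant that keeps the
-- quantile 1 out of the gap.
theorem line_le_cumul (q : ℝ) (hq : q ∈ Icc (0 : ℝ) 1) :
    cumul ν x 1 + 1 * (q - 1) ≤ cumul ν x q := by
  have h1 : (1 : ℝ) ∈ Icc (0 : ℝ) 1 := by simp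
  have h := setIntegral_distr_Ioo ν hx hx0 hx1 hq h1 hq.2
  have hle : ∫ v in distr ν ⁻¹' Ioo q 1, x v ∂ν ≤ ∫ v in distr ν ⁻¹' Ioo q 1, (1 : ℝ) ∂ν :=
    integral_mono (integrable_of_mem_unit hx hx0 hx1) (integrable_const _) hx1
  rw [setIntegral_const, measureReal_distr_Ioo ν hq h1 hq.2, smul_eq_mul] at hle
  linarith

include hx hx0 hx1 in
theorem continuousOn_cumul : ContinuousOn (cumul ν x) (Icc 0 1) := by
  have h := intervalIntegrable_quantile ν hx hx0 hx1 (a := 0) (b := 1) (by simp) (by simp)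
  have := intervalIntegral.continuousOn_primitive_interval (a := 0) (b := 1) (μ := volume)
    (f := fun z => x (quantile ν z)) (by
      rw [uIcc_of_le zero_le_one, integrableOn_Icc_iff_integrableOn_Ioc]
      exact (intervalIntegrable_iff_integrableOn_Ioc_of_le zero_le_one).1 h)
  rwa [uIcc_of_le zero_le_one] at this

include hx hx0 hx1 in
-- Lebesgue differentiation holds off a null set of quantiles, whose preimage under `F` is null
-- because `F(v)` is uniform. Almost every `v` is moreover the quantile of `F(v)`.
theorem ae_hasDerivAt_cumul : ∀ᵐ v ∂ν, HasDerivAt (cumul ν x) (x v) (distr ν v) := by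
  have h := (intervalIntegrable_quantile ν hx hx0 hx1 (a := 0) (b := 1) (by simp)
    (by simp)).ae_hasDerivAt_integral
  obtain ⟨N, hN, hNm, hN0⟩ := exists_measurable_superset_of_null (ae_iff.1 h)
  have hF : ∀ᵐ v ∂ν, distr ν v ∉ N := by
    have h' := measure_distr_preimage ν hNm
    rw [measure_mono_null inter_subset_left hN0] at h'
    rw [ae_iff]
    simpa only [not_not] using! h'
  filter_upwards [hF, ae_distr_lt ν] with v hv hlt
  have := not_not.1 fun hn => hv (hN hn)
  rw [uIcc_of_le zero_le_one] at this
  have h2 := this (distr_mem_Icc ν v) 0 (by simp)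
  rwa [quantile_distr ν hlt] at h2

end Cumul

/-! ### Redrawing a bid -/

section Redraw

variable {ν : Measure ℝ≥0} [IsProbabilityMeasure ν] [NullSingletonClass ν] {x : ℝ≥0 → ℝ}

omit [NullSingletonClass ν] in
theorem ironSet_eq : ironSet ν x = distr ν ⁻¹' gapSet (cumul ν x) := by
  ext v
  exact ⟨fun h => ⟨distr_mem_Icc ν v, h⟩, fun h => h.2⟩

omit [IsProbabilityMeasure ν] [NullSingletonClass ν] in
theorem redraw_of_notMem {v : ℝ≥0} (hv : v ∉ ironSet ν x) : redraw ν x v = .dirac v :=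
  if_neg hv

/-- `F` is continuous, so a path from `v` that leaves the preimage of the interval takes the value
`α` or `β`, and neither is in the gap. -/
theorem ordConnectedComponent_ironSet {α β : ℝ} (hα : α ∉ gapSet (cumul ν x))
    (hβ : β ∉ gapSet (cumul ν x)) (hsub : Ioo α β ⊆ gapSet (cumul ν x)) {v : ℝ≥0}
    (hv : distr ν v ∈ Ioo α β) :
    (ironSet ν x).ordConnectedComponent v = distr ν ⁻¹' Ioo α β := by
  rw [ironSet_eq]
  apply Subset.antisymm
  · intro y hy
    rw [mem_ordConnectedComponent] at hy
    have hiv := intermediate_value_uIcc (continuous_distr ν).continuousOn (a := v) (b := y)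
    refine ⟨not_le.1 fun h => hα ?_, not_le.1 fun h => hβ ?_⟩
    · obtain ⟨w, hw, rfl⟩ := hiv (mem_uIcc.2 (.inr ⟨h, hv.1.le⟩))
      exact hy hw
    · obtain ⟨w, hw, rfl⟩ := hiv (mem_uIcc.2 (.inl ⟨hv.2.le, h⟩))
      exact hy hw
  · have : OrdConnected (distr ν ⁻¹' Ioo α β) := ordConnected_Ioo.preimage_mono (distr_mono ν)
    exact subset_ordConnectedComponent hv (preimage_mono hsub)

theorem redraw_of_mem {α β : ℝ} (hα : α ∉ gapSet (cumul ν x))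
    (hβ : β ∉ gapSet (cumul ν x)) (hsub : Ioo α β ⊆ gapSet (cumul ν x)) {v : ℝ≥0}
    (hv : distr ν v ∈ Ioo α β) :
    redraw ν x v = ProbabilityTheory.cond ν (distr ν ⁻¹' Ioo α β) := by
  have hmem : v ∈ ironSet ν x := by rw [ironSet_eq]; exact hsub hv
  rw [redraw, if_pos hmem, ordConnectedComponent_ironSet hα hβ hsub hv]

variable (hx : Measurable x) (hx0 : ∀ v, 0 ≤ x v) (hx1 : ∀ v, x v ≤ 1)

include hx hx0 hx1 in
theorem exists_Ioo_of_mem_ironSet {v : ℝ≥0} (hv : v ∈ ironSet ν x) :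
    ∃ α β, α ∈ Icc (0 : ℝ) 1 ∧ β ∈ Icc (0 : ℝ) 1 ∧ α ∉ gapSet (cumul ν x) ∧
      β ∉ gapSet (cumul ν x) ∧ distr ν v ∈ Ioo α β ∧ Ioo α β ⊆ gapSet (cumul ν x) := by
  rw [ironSet_eq] at hv
  exact exists_Ioo_subset_gapSet (cumul_nonneg ν hx0) (cumul_zero ν)
    (line_le_cumul ν hx hx0 hx1) (continuousOn_cumul ν hx hx0 hx1) hv

include hx hx0 hx1 in
theorem isProbabilityMeasure_redraw (v : ℝ≥0) : IsProbabilityMeasure (redraw ν x v) := by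
  by_cases hv : v ∈ ironSet ν x
  · obtain ⟨α, β, hα, hβ, hα', hβ', hm, hsub⟩ := exists_Ioo_of_mem_ironSet hx hx0 hx1 hv
    rw [redraw_of_mem hα' hβ' hsub hm]
    refine cond_isProbabilityMeasure fun h0 => ?_
    have h := measureReal_distr_Ioo ν hα hβ (hm.1.trans hm.2).le
    rw [Measure.real, h0, ENNReal.toReal_zero] at h
    linarith [hm.1, hm.2]
  · rw [redraw_of_notMem hv]; infer_instance

/-- The maximal intervals of the ironed set. -/
def ironIntervals (ν : Measure ℝ≥0) (x : ℝ≥0 → ℝ) : Set (Set ℝ≥0) :=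
  (ironSet ν x).ordConnectedComponent '' ironSet ν x

include hx hx0 hx1 in
theorem isOpen_of_mem_ironIntervals {I : Set ℝ≥0} (hI : I ∈ ironIntervals ν x) : IsOpen I := by
  obtain ⟨v, hv, rfl⟩ := hI
  obtain ⟨α, β, hα, hβ, hα', hβ', hm, hsub⟩ := exists_Ioo_of_mem_ironSet hx hx0 hx1 hv
  rw [ordConnectedComponent_ironSet hα' hβ' hsub hm]
  exact isOpen_Ioo.preimage (continuous_distr ν)

omit [IsProbabilityMeasure ν] [NullSingletonClass ν] in
theorem ordConnectedComponent_eq_of_mem {v : ℝ≥0} {I : Set ℝ≥0} (hI : I ∈ ironIntervals ν x)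
    (hv : v ∈ I) : (ironSet ν x).ordConnectedComponent v = I := by
  obtain ⟨u, hu, rfl⟩ := hI
  exact (ordConnectedComponent_eq (mem_ordConnectedComponent.1 hv)).symm

omit [IsProbabilityMeasure ν] [NullSingletonClass ν] in
theorem pairwiseDisjoint_ironIntervals : (ironIntervals ν x).PairwiseDisjoint id := by
  intro I hI J hJ hne
  refine disjoint_left.2 fun v hvI hvJ => hne ?_
  rw [← ordConnectedComponent_eq_of_mem hI hvI, ordConnectedComponent_eq_of_mem hJ hvJ]

include hx hx0 hx1 in
theorem countable_ironIntervals : (ironIntervals ν x).Countable := by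
  refine pairwiseDisjoint_ironIntervals.countable_of_isOpen
    (fun I hI => isOpen_of_mem_ironIntervals hx hx0 hx1 hI) ?_
  rintro _ ⟨v, hv, rfl⟩
  exact nonempty_ordConnectedComponent.2 hv

omit [IsProbabilityMeasure ν] [NullSingletonClass ν] in
theorem sUnion_ironIntervals : ⋃₀ ironIntervals ν x = ironSet ν x := by
  apply Subset.antisymm
  · rintro v ⟨_, ⟨u, -, rfl⟩, hv⟩
    exact ordConnectedComponent_subset hv
  · exact fun v hv => ⟨_, ⟨v, hv, rfl⟩, self_mem_ordConnectedComponent.2 hv⟩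

include hx hx0 hx1 in
theorem measurableSet_ironSet : MeasurableSet (ironSet ν x) := by
  rw [← sUnion_ironIntervals]
  exact (isOpen_sUnion fun I hI => isOpen_of_mem_ironIntervals hx hx0 hx1 hI).measurableSet

omit [IsProbabilityMeasure ν] [NullSingletonClass ν] in
-- At most one maximal interval contains `v`, so at most one term of the series is nonzero. The
-- series form yields measurability in `v` and can be integrated term by term.
theorem redraw_apply {s : Set ℝ≥0} (hs : MeasurableSet s) (v : ℝ≥0) :
    redraw ν x v s = ((ironSet ν x)ᶜ ∩ s).indicator 1 v +
      ∑' I : ironIntervals ν x, (I : Set ℝ≥0).indicator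
        (fun _ => ProbabilityTheory.cond ν (I : Set ℝ≥0) s) v := by
  by_cases hv : v ∈ ironSet ν x
  · have hI : (ironSet ν x).ordConnectedComponent v ∈ ironIntervals ν x := ⟨v, hv, rfl⟩
    rw [tsum_eq_single ⟨_, hI⟩, indicator_of_notMem (fun h => h.1 hv), zero_add,
      indicator_of_mem (self_mem_ordConnectedComponent.2 hv), redraw, if_pos hv]
    intro J hJ
    refine indicator_of_notMem (fun h => hJ (Subtype.ext ?_)) _
    exact (ordConnectedComponent_eq_of_mem J.2 h).symm
  · have h0 : ∀ I : ironIntervals ν x, (I : Set ℝ≥0).indicator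
        (fun _ => ProbabilityTheory.cond ν (I : Set ℝ≥0) s) v = 0 := fun I =>
      indicator_of_notMem (fun h => hv (sUnion_ironIntervals.subset ⟨I, I.2, h⟩)) _
    simp_rw [h0, tsum_zero, add_zero, redraw, if_neg hv, Measure.dirac_apply' _ hs]
    by_cases hvs : v ∈ s <;> simp [hv, hvs]

include hx hx0 hx1 in
theorem measurable_redraw : Measurable (redraw ν x) := by
  refine Measure.measurable_of_measurable_coe _ fun s hs => ?_
  have := (countable_ironIntervals (ν := ν) hx hx0 hx1).to_subtype
  simp_rw [redraw_apply hs]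
  refine (measurable_one.indicator
    ((measurableSet_ironSet hx hx0 hx1).compl.inter hs)).add (Measurable.tsum fun I => ?_)
  exact measurable_const.indicator (isOpen_of_mem_ironIntervals hx hx0 hx1 I.2).measurableSet

include hx hx0 hx1 in
/-- Redrawing preserves the distribution of the bid. -/
theorem bind_redraw : ν.bind (redraw ν x) = ν := by
  have := (countable_ironIntervals (ν := ν) hx hx0 hx1).to_subtype
  have hU := measurableSet_ironSet (ν := ν) hx hx0 hx1
  have hI : ∀ I : ironIntervals ν x, MeasurableSet (I : Set ℝ≥0) := fun I =>
    (isOpen_of_mem_ironIntervals hx hx0 hx1 I.2).measurableSet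
  ext s hs
  rw [Measure.bind_apply hs (measurable_redraw hx hx0 hx1).aemeasurable]
  simp_rw [redraw_apply hs]
  rw [lintegral_add_left (measurable_one.indicator (hU.compl.inter hs)),
    lintegral_indicator_one (hU.compl.inter hs),
    lintegral_tsum fun I => (measurable_const.indicator (hI I)).aemeasurable]
  have hterm : ∀ I : ironIntervals ν x, ∫⁻ v, (I : Set ℝ≥0).indicator
      (fun _ => ProbabilityTheory.cond ν (I : Set ℝ≥0) s) v ∂ν = ν ((I : Set ℝ≥0) ∩ s) := by
    intro I
    rw [lintegral_indicator_const (hI I), mul_comm, mul_comm]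
    exact cond_mul_eq_inter (hI I) s ν
  simp_rw [hterm]
  have hd : Pairwise (Function.onFun Disjoint
      fun I : ironIntervals ν x => (I : Set ℝ≥0) ∩ s) := fun I J hIJ =>
    (pairwiseDisjoint_ironIntervals I.2 J.2 (fun h => hIJ (Subtype.ext h))).mono
      inter_subset_left inter_subset_left
  rw [← measure_iUnion hd fun I => (hI I).inter hs, ← iUnion_inter, ← sUnion_eq_iUnion, sUnion_ironIntervals,
    inter_comm, inter_comm _ s, add_comm, ← sdiff_eq, measure_inter_add_sdiff s hU]

/-! ### The ironed allocation rule -/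

/-- The ironed allocation rule: the average of `x` over the redraw. -/
noncomputable def ironed (ν : Measure ℝ≥0) (x : ℝ≥0 → ℝ) (v : ℝ≥0) : ℝ := ∫ w, x w ∂(redraw ν x v)

include hx in
omit [IsProbabilityMeasure ν] [NullSingletonClass ν] in
theorem ironed_of_notMem {v : ℝ≥0} (hv : v ∉ ironSet ν x) : ironed ν x v = x v := by
  rw [ironed, redraw_of_notMem hv, integral_dirac' _ _ hx.stronglyMeasurable]

include hx hx0 hx1 in
theorem ironed_of_mem {α β : ℝ} (hα₀ : α ∈ Icc (0 : ℝ) 1) (hβ₀ : β ∈ Icc (0 : ℝ) 1)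
    (hα : α ∉ gapSet (cumul ν x)) (hβ : β ∉ gapSet (cumul ν x))
    (hsub : Ioo α β ⊆ gapSet (cumul ν x)) {v : ℝ≥0} (hv : distr ν v ∈ Ioo α β) :
    ironed ν x v = (cumul ν x β - cumul ν x α) / (β - α) := by
  have hle := (hv.1.trans hv.2).le
  rw [ironed, redraw_of_mem hα hβ hsub hv, ProbabilityTheory.cond, integral_smul_measure,
    setIntegral_distr_Ioo ν hx hx0 hx1 hα₀ hβ₀ hle, ENNReal.toReal_inv, ← Measure.real,
    measureReal_distr_Ioo ν hα₀ hβ₀ hle, smul_eq_mul, inv_mul_eq_div]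

include hx hx0 hx1 in
/-- The ironed allocation rule is almost everywhere a subgradient of the convex hull. -/
theorem ae_ironed_subgradient : ∀ᵐ v ∂ν, ∀ t ∈ Icc (0 : ℝ) 1,
    convHull (cumul ν x) (distr ν v) + ironed ν x v * (t - distr ν v) ≤
      convHull (cumul ν x) t := by
  have h0 := cumul_nonneg ν hx0
  have hc := continuousOn_cumul ν hx hx0 hx1
  filter_upwards [ae_hasDerivAt_cumul ν hx hx0 hx1, ae_distr_mem_Ioo ν] with v hd hv t ht
  by_cases hmem : v ∈ ironSet ν x
  · obtain ⟨α, β, hα, hβ, hα', hβ', hm, hsub⟩ := exists_Ioo_of_mem_ironSet hx hx0 hx1 hmem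
    have hαβ := hm.1.trans hm.2
    have hmul : (cumul ν x β - cumul ν x α) / (β - α) * (β - α) = cumul ν x β - cumul ν x α :=
      div_mul_cancel₀ _ (sub_pos.2 hαβ).ne'
    have h1 := chord_le_convHull h0 hc hα hβ hαβ hα' hβ' hsub ht
    -- Convexity puts the hull below the chord at `F(v)`, while `h1` puts the chord below the hull
    -- everywhere. The line through the hull at `F(v)` with the slope of the chord therefore
    -- supports the hull.
    have h2 := (convexOn_convHull h0).slope_mono_adjacent hα hβ hm.1 hm.2
    rw [convHull_eq_of_notMem h0 hα hα', convHull_eq_of_notMem h0 hβ hβ',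
      div_le_div_iff₀ (sub_pos.2 hm.1) (sub_pos.2 hm.2)] at h2
    rw [ironed_of_mem hx hx0 hx1 hα hβ hα' hβ' hsub hm]
    set m := (cumul ν x β - cumul ν x α) / (β - α)
    have h3 : convHull (cumul ν x) (distr ν v) ≤ cumul ν x α + m * (distr ν v - α) := by
      refine le_of_mul_le_mul_right ?_ (sub_pos.2 hαβ)
      linear_combination h2 - (distr ν v - α) * hmul
    linarith
  · rw [ironed_of_notMem hx hmem]
    have hn : distr ν v ∉ gapSet (cumul ν x) := by rwa [ironSet_eq] at hmem
    rw [convHull_eq_of_notMem h0 (Ioo_subset_Icc_self hv) hn]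
    exact tangent_le_convHull h0 hv hn hd ht

include hx hx0 hx1 in
/-- The ironed allocation rule is monotone outside a null set. -/
theorem exists_monotoneOn_ironed :
    ∃ D : Set ℝ≥0, MeasurableSet D ∧ ν Dᶜ = 0 ∧ MonotoneOn (ironed ν x) D := by
  obtain ⟨N, hN, hNm, hN0⟩ := exists_measurable_superset_of_null
    (ae_iff.1 ((ae_ironed_subgradient (ν := ν) hx hx0 hx1).and (ae_distr_lt ν)))
  refine ⟨Nᶜ, hNm.compl, by rwa [compl_compl], fun u hu v hv huv => ?_⟩
  have hu' := not_not.1 fun hn => hu (hN hn)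
  have hv' := not_not.1 fun hn => hv (hN hn)
  rcases huv.eq_or_lt with rfl | huv
  · rfl
  · have hlt := hv'.2 u huv
    -- Adding the two subgradient inequalities gives `(y v - y u) * (F v - F u) ≥ 0` for the ironed
    -- rule `y`, and `hlt` makes the second factor positive.
    have h1 := hu'.1 _ (distr_mem_Icc ν v)
    have h2 := hv'.1 _ (distr_mem_Icc ν u)
    nlinarith

omit [IsProbabilityMeasure ν] [NullSingletonClass ν] in
include hx0 in
theorem ironed_nonneg (v : ℝ≥0) : 0 ≤ ironed ν x v := integral_nonneg hx0

include hx hx0 hx1 in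
theorem ironed_le_one (v : ℝ≥0) : ironed ν x v ≤ 1 := by
  have := isProbabilityMeasure_redraw (ν := ν) hx hx0 hx1 v
  refine (integral_mono (integrable_of_mem_unit hx hx0 hx1) (integrable_const 1) hx1).trans ?_
  simp

include hx hx0 hx1 in
theorem measurable_ironed : Measurable (ironed ν x) :=
  (StronglyMeasurable.integral_kernel (κ := ⟨_, measurable_redraw hx hx0 hx1⟩)
    hx.stronglyMeasurable).measurable

include hx hx0 hx1 in
/-- Redrawing does not move a bid across a quantile at which the cumulative rule meets its hull. -/
theorem setIntegral_ironed_eq {q : ℝ} (hq : q ∉ gapSet (cumul ν x)) :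
    ∫ v in distr ν ⁻¹' Iic q, ironed ν x v ∂ν = ∫ v in distr ν ⁻¹' Iic q, x v ∂ν := by
  have := isProbabilityMeasure_redraw (ν := ν) hx hx0 hx1
  have hs : MeasurableSet (distr ν ⁻¹' Iic q) := measurableSet_Iic.preimage (distr_mono ν).measurable
  have hxs := hx.indicator hs
  -- Since `q` is not in the gap, each ironing interval lies entirely on one side of it, so
  -- truncating at `q` commutes with averaging over the redraw.
  have hpt : ∀ v, (distr ν ⁻¹' Iic q).indicator (ironed ν x) v =
      ∫ w, (distr ν ⁻¹' Iic q).indicator x w ∂(redraw ν x v) := by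
    intro v
    by_cases hv : v ∈ ironSet ν x
    · obtain ⟨α, β, hα, hβ, hα', hβ', hm, hsub⟩ := exists_Ioo_of_mem_ironSet hx hx0 hx1 hv
      have hae : ∀ᵐ w ∂(redraw ν x v), distr ν w ∈ Ioo α β := by
        rw [redraw_of_mem hα' hβ' hsub hm]
        exact ae_cond_mem (measurableSet_Ioo.preimage (distr_mono ν).measurable)
      rcases le_or_gt q α with h | h
      · rw [indicator_of_notMem (s := distr ν ⁻¹' Iic q) (a := v)
          (fun hn => (hm.1.trans_le hn).not_ge h)]
        refine (integral_eq_zero_of_ae ?_).symm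
        filter_upwards [hae] with w hw
        exact indicator_of_notMem (s := distr ν ⁻¹' Iic q) (a := w)
          (fun hn => (hw.1.trans_le hn).not_ge h) _
      · have h' : β ≤ q := not_lt.1 fun h' => hq (hsub ⟨h, h'⟩)
        rw [indicator_of_mem (s := distr ν ⁻¹' Iic q) (a := v) (show _ ≤ q from hm.2.le.trans h')]
        refine integral_congr_ae ?_
        filter_upwards [hae] with w hw
        rw [indicator_of_mem (s := distr ν ⁻¹' Iic q) (a := w) (show _ ≤ q from hw.2.le.trans h')]
    · rw [redraw_of_notMem hv, integral_dirac' _ _ hxs.stronglyMeasurable]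
      by_cases hvs : v ∈ distr ν ⁻¹' Iic q
      · rw [indicator_of_mem hvs, indicator_of_mem hvs, ironed_of_notMem hx hv]
      · rw [indicator_of_notMem hvs, indicator_of_notMem hvs]
  rw [← integral_indicator hs, ← integral_indicator hs]
  simp_rw [hpt]
  rw [← integral_bind_of_nonneg (measurable_redraw hx hx0 hx1) hxs
    (indicator_nonneg fun v _ => hx0 v)
    (indicator_le' (fun v _ => hx1 v) fun _ _ => zero_le_one), bind_redraw hx hx0 hx1]

include hx hx0 hx1 in
-- Inside a gap the cumulative ironed rule starts from `G α` and follows the chord, which is below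
-- the hull and hence below `G`.
theorem setIntegral_ironed_le {q : ℝ} (hq : q ∈ Icc (0 : ℝ) 1) :
    ∫ v in distr ν ⁻¹' Iic q, ironed ν x v ∂ν ≤ ∫ v in distr ν ⁻¹' Iic q, x v ∂ν := by
  by_cases hgap : q ∈ gapSet (cumul ν x)
  · have h0 := cumul_nonneg ν hx0
    have hc := continuousOn_cumul ν hx hx0 hx1
    have hym := measurable_ironed (ν := ν) hx hx0 hx1
    have hy0 := ironed_nonneg (ν := ν) hx0
    have hy1 := ironed_le_one (ν := ν) hx hx0 hx1
    obtain ⟨α, β, hα, hβ, hα', hβ', hm, hsub⟩ := exists_Ioo_subset_gapSet h0 (cumul_zero ν)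
      (line_le_cumul ν hx hx0 hx1) hc hgap
    have hchord := chord_le_convHull h0 hc hα hβ (hm.1.trans hm.2) hα' hβ' hsub hq
    have h1 := setIntegral_ironed_eq hx hx0 hx1 hα'
    rw [setIntegral_distr_Iic ν hym hy0 hy1 hα, setIntegral_distr_Iic ν hx hx0 hx1 hα] at h1
    have h2 := setIntegral_distr_Ioo ν hym hy0 hy1 hα hq hm.1.le
    rw [setIntegral_congr_fun (g := fun _ => (cumul ν x β - cumul ν x α) / (β - α))
      (measurableSet_Ioo.preimage (distr_mono ν).measurable) fun v hv =>
        ironed_of_mem hx hx0 hx1 hα hβ hα' hβ' hsub ⟨hv.1, hv.2.trans hm.2⟩,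
      setIntegral_const, measureReal_distr_Ioo ν hα hq hm.1.le, smul_eq_mul] at h2
    rw [setIntegral_distr_Iic ν hym hy0 hy1 hq, setIntegral_distr_Iic ν hx hx0 hx1 hq]
    have := hgap.2
    linarith
  · exact (setIntegral_ironed_eq hx hx0 hx1 hgap).le

include hx hx0 hx1 in
-- The ironed rule serves no more below the threshold, and the totals agree because redrawing
-- preserves the prior.
theorem setIntegral_Ioi_le_ironed (t : ℝ≥0) :
    ∫ v in Ioi t, x v ∂ν ≤ ∫ v in Ioi t, ironed ν x v ∂ν := by
  have := isProbabilityMeasure_redraw (ν := ν) hx hx0 hx1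
  have hle := setIntegral_ironed_le (ν := ν) hx hx0 hx1 (distr_mem_Icc ν t)
  rw [← setIntegral_congr_set (Iic_ae_eq_distr_preimage ν t),
    ← setIntegral_congr_set (Iic_ae_eq_distr_preimage ν t)] at hle
  have htot : ∫ v, ironed ν x v ∂ν = ∫ v, x v ∂ν := by
    unfold ironed
    rw [← integral_bind_of_nonneg (measurable_redraw hx hx0 hx1) hx hx0 hx1,
      bind_redraw hx hx0 hx1]
  have h1 := integral_add_compl (μ := ν) (measurableSet_Iic (a := t))
    (integrable_of_mem_unit hx hx0 hx1)
  have h2 := integral_add_compl (μ := ν) (measurableSet_Iic (a := t))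
    (integrable_of_mem_unit (measurable_ironed (ν := ν) hx hx0 hx1) (ironed_nonneg hx0)
      (ironed_le_one hx hx0 hx1))
  rw [compl_Iic] at h1 h2
  linarith

end Redraw

/-- If `y` serves the values above each threshold at least as much as `x` does, then `y` serves at
least as much value. -/
theorem integral_mul_le_of_setIntegral_Ioi_le {ν : Measure ℝ≥0} [IsFiniteMeasure ν]
    (hν : Integrable (fun v : ℝ≥0 => (v : ℝ)) ν) {x y : ℝ≥0 → ℝ} (hx : Measurable x)
    (hx0 : ∀ v, 0 ≤ x v) (hx1 : ∀ v, x v ≤ 1) (hy : Measurable y) (hy0 : ∀ v, 0 ≤ y v)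
    (hy1 : ∀ v, y v ≤ 1) (h : ∀ t, ∫ v in Ioi t, x v ∂ν ≤ ∫ v in Ioi t, y v ∂ν) :
    ∫ v, (v : ℝ) * x v ∂ν ≤ ∫ v, (v : ℝ) * y v ∂ν := by
  have hlayer : ∀ {z : ℝ≥0 → ℝ}, Measurable z → (∀ v, 0 ≤ z v) →
      ∫⁻ v : ℝ≥0, ENNReal.ofReal ((v : ℝ) * z v) ∂ν =
        ∫⁻ t in Ioi (0 : ℝ), ∫⁻ v in Ioi t.toNNReal, ENNReal.ofReal (z v) ∂ν := by
    intro z hz hz0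
    have hm : Measurable fun v : ℝ≥0 => ENNReal.ofReal (v : ℝ) :=
      measurable_id.coe_nnreal_real.ennreal_ofReal
    -- Layer-cake formula for the identity function under the measure with density `z`.
    have hl := lintegral_eq_lintegral_meas_lt (ν.withDensity fun v => ENNReal.ofReal (z v))
      (f := fun v : ℝ≥0 => (v : ℝ)) (.of_forall fun v => v.2)
      measurable_id.coe_nnreal_real.aemeasurable
    rw [lintegral_withDensity_eq_lintegral_mul _ hz.ennreal_ofReal hm] at hl
    calc _ = ∫⁻ v, ((fun v => ENNReal.ofReal (z v)) * fun v : ℝ≥0 => ENNReal.ofReal (v : ℝ)) v ∂ν :=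
          lintegral_congr fun v => by
            rw [mul_comm, ENNReal.ofReal_mul (hz0 v)]; rfl
      _ = _ := hl
      _ = _ := by
        refine setLIntegral_congr_fun measurableSet_Ioi fun t ht => ?_
        have hset : {a : ℝ≥0 | t < (a : ℝ)} = Ioi t.toNNReal := by
          ext a
          rw [mem_ofPred_eq, mem_Ioi, Real.toNNReal_lt_iff_lt_coe (le_of_lt ht)]
        rw [hset, withDensity_apply _ measurableSet_Ioi]
  have hint : ∀ {z : ℝ≥0 → ℝ}, Measurable z → (∀ v, 0 ≤ z v) → (∀ v, z v ≤ 1) →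
      Integrable (fun v : ℝ≥0 => (v : ℝ) * z v) ν := fun hz hz0 hz1 =>
    hν.mul_of_top_left (memLp_top_of_bound hz.aestronglyMeasurable 1 (.of_forall fun v => by
      rw [Real.norm_of_nonneg (hz0 v)]; exact hz1 v))
  have hnn : ∀ {z : ℝ≥0 → ℝ}, (∀ v, 0 ≤ z v) → 0 ≤ᵐ[ν] fun v : ℝ≥0 => (v : ℝ) * z v :=
    fun hz0 => .of_forall fun v => mul_nonneg v.2 (hz0 v)
  rw [← ENNReal.ofReal_le_ofReal_iff (integral_nonneg_of_ae (hnn hy0)),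
    ofReal_integral_eq_lintegral_ofReal (hint hx hx0 hx1) (hnn hx0),
    ofReal_integral_eq_lintegral_ofReal (hint hy hy0 hy1) (hnn hy0), hlayer hx hx0,
    hlayer hy hy0]
  refine lintegral_mono fun t => ?_
  simp only
  rw [← ofReal_integral_eq_lintegral_ofReal (integrable_of_mem_unit hx hx0 hx1) (.of_forall hx0),
    ← ofReal_integral_eq_lintegral_ofReal (integrable_of_mem_unit hy hy0 hy1) (.of_forall hy0)]
  exact ENNReal.ofReal_le_ofReal (h _)

/-! ### Expected welfare -/

theorem extExpect_congr {Ω : Type*} [MeasurableSpace Ω] {P : Measure Ω} {f g : Ω → EReal}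
    (h : f =ᵐ[P] g) : extExpect P f = extExpect P g := by
  unfold extExpect
  have h1 : ∫⁻ ω, (f ω).toENNReal ∂P = ∫⁻ ω, (g ω).toENNReal ∂P :=
    lintegral_congr_ae (h.fun_comp EReal.toENNReal)
  have h2 : ∫⁻ ω, (-f ω).toENNReal ∂P = ∫⁻ ω, (-g ω).toENNReal ∂P :=
    lintegral_congr_ae (h.fun_comp fun y => (-y).toENNReal)
  rw [h1, h2]

theorem extExpect_coe {Ω : Type*} [MeasurableSpace Ω] {P : Measure Ω} {f : Ω → ℝ}
    (hf : Integrable f P) : extExpect P (fun ω => (f ω : EReal)) = ((∫ ω, f ω ∂P : ℝ) : EReal) := by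
  have h1 : ∫⁻ ω, ENNReal.ofReal (f ω) ∂P ≠ ⊤ := hf.lintegral_lt_top.ne
  have h2 : ∫⁻ ω, ENNReal.ofReal (-f ω) ∂P ≠ ⊤ := hf.neg.lintegral_lt_top.ne
  rw [integral_eq_lintegral_pos_part_sub_lintegral_neg_part hf, EReal.coe_sub,
    EReal.coe_ennreal_toReal h1, EReal.coe_ennreal_toReal h2]
  simp only [extExpect, ← EReal.coe_neg, EReal.real_coe_toENNReal]

/-- The negative part has infinite integral, and in `EReal` subtracting `⊤` gives `⊥` even from `⊤`.
-/
theorem extExpect_eq_bot {Ω : Type*} [MeasurableSpace Ω] {P : Measure Ω} {f : Ω → EReal}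
    {s : Set Ω} (hs : MeasurableSet s) (h0 : P s ≠ 0) (hf : ∀ ω ∈ s, f ω = ⊥) :
    extExpect P f = ⊥ := by
  have htop : ∫⁻ ω, (-f ω).toENNReal ∂P = ⊤ := by
    refine top_unique ?_
    calc (⊤ : ℝ≥0∞) = ∫⁻ ω, s.indicator (fun _ => ⊤) ω ∂P := by
          rw [lintegral_indicator_const hs, ENNReal.top_mul h0]
      _ ≤ _ := lintegral_mono fun ω => by
          by_cases hω : ω ∈ s
          · simp [hω, hf ω hω]
          · simp [hω]
  rw [extExpect, htop, EReal.coe_ennreal_top, EReal.sub_top]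

theorem coe_finsetSum {ι : Type*} (s : Finset ι) (f : ι → ℝ) :
    ((∑ i ∈ s, f i : ℝ) : EReal) = ∑ i ∈ s, (f i : EReal) := by
  classical
  induction s using Finset.induction_on with
  | empty => simp
  | insert a s ha ih => rw [Finset.sum_insert ha, Finset.sum_insert ha, EReal.coe_add, ih]

section Welfare

variable {n : ℕ} {c : Finset (Fin n) → EReal} {μ : Fin n → Measure ℝ≥0}

theorem welfare_eq_bot (A : Alg n) {S : Finset (Fin n)} (hS : c S = ⊤)
    (h : ∫ v, A.prob v S ∂(Measure.pi μ) ≠ 0) : welfare c μ A = ⊥ := by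
  refine extExpect_eq_bot (s := {v | 0 < A.prob v S})
    (measurableSet_lt measurable_const (A.measurable_prob S)) (fun h0 => h ?_) fun v hv => ?_
  · refine integral_eq_zero_of_ae ?_
    have : ∀ᵐ v ∂(Measure.pi μ), ¬ 0 < A.prob v S := by
      rw [ae_iff]; simpa only [not_not] using! h0
    filter_upwards [this] with v hv
    exact le_antisymm (not_lt.1 hv) (A.nonneg v S)
  · rw [welfareAt, ← Finset.add_sum_erase _ _ (Finset.mem_univ S), welfareOf, hS, EReal.sub_top,
      EReal.coe_mul_bot_of_pos hv, EReal.bot_add]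

variable [∀ i, IsProbabilityMeasure (μ i)]

/-- Exchanging the sums over sets and agents shows that welfare depends on `A` only through the
interim rules and the overall probability of each set. -/
theorem welfare_eq_coe (hc : ∀ S, c S ≠ ⊥) (hμ : ∀ i, Integrable (fun v : ℝ≥0 => (v : ℝ)) (μ i))
    (A : Alg n) (h : ∀ S, c S = ⊤ → ∫ v, A.prob v S ∂(Measure.pi μ) = 0) :
    welfare c μ A = ((∑ i, ∫ t, (t : ℝ) * A.interim μ i t ∂(μ i) -
      ∑ S, (∫ v, A.prob v S ∂(Measure.pi μ)) * (c S).toReal : ℝ) : EReal) := by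
  have hnull : ∀ᵐ v ∂(Measure.pi μ), ∀ S, c S = ⊤ → A.prob v S = 0 := by
    refine ae_all_iff.2 fun S => ?_
    by_cases hS : c S = ⊤
    · have := (integral_eq_zero_iff_of_nonneg (fun v => A.nonneg v S)
        (A.integrable_prob S _)).1 (h S hS)
      filter_upwards [this] with v hv _ using hv
    · exact .of_forall fun v hv => absurd hv hS
  have hpt : ∀ v : Profile n, ∑ S, A.prob v S * (∑ i ∈ S, (v i : ℝ) - (c S).toReal) =
      ∑ i, (v i : ℝ) * A.serve v i - ∑ S, A.prob v S * (c S).toReal := by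
    intro v
    simp_rw [mul_sub, Finset.sum_sub_distrib, Alg.serve, Finset.mul_sum]
    rw [Finset.sum_comm]
    congr 1
    refine Finset.sum_congr rfl fun S _ => ?_
    simp only [mul_ite, mul_zero, Finset.sum_ite_mem, Finset.univ_inter]
    exact Finset.sum_congr rfl fun i _ => mul_comm _ _
  have hint1 : ∀ i, Integrable (fun v : Profile n => (v i : ℝ) * A.serve v i) (Measure.pi μ) :=
    fun i => (integrable_comp_eval (i := i) (hμ i)).mul_of_top_left (memLp_top_of_bound
      (A.measurable_serve i).aestronglyMeasurable 1 (.of_forall fun v => by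
        rw [Real.norm_of_nonneg (A.serve_nonneg _ i)]; exact A.serve_le_one _ i))
  have hint2 : ∀ S, Integrable (fun v => A.prob v S * (c S).toReal) (Measure.pi μ) :=
    fun S => (A.integrable_prob S _).mul_const _
  have hae : welfareAt c A =ᵐ[Measure.pi μ] fun v =>
      ((∑ i, (v i : ℝ) * A.serve v i - ∑ S, A.prob v S * (c S).toReal : ℝ) : EReal) := by
    filter_upwards [hnull] with v hv
    rw [← hpt, coe_finsetSum, welfareAt]
    refine Finset.sum_congr rfl fun S _ => ?_
    by_cases hS : c S = ⊤
    -- A zero probability kills both sides, so the default value of `toReal` at `⊤` plays no role.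
    · simp [hv S hS]
    · rw [EReal.coe_mul, EReal.coe_sub, EReal.coe_toReal hS (hc S), welfareOf]
  have hsum1 : Integrable (fun v : Profile n => ∑ i, (v i : ℝ) * A.serve v i) (Measure.pi μ) :=
    integrable_finsetSum _ fun i _ => hint1 i
  have hsum2 : Integrable (fun v => ∑ S, A.prob v S * (c S).toReal) (Measure.pi μ) :=
    integrable_finsetSum _ fun S _ => hint2 S
  rw [welfare, extExpect_congr hae, extExpect_coe (f := fun v => ∑ i, (v i : ℝ) * A.serve v i -
      ∑ S, A.prob v S * (c S).toReal) (hsum1.sub hsum2), integral_sub hsum1 hsum2,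
    integral_finsetSum _ fun i _ => hint1 i, integral_finsetSum _ fun S _ => hint2 S]
  simp_rw [integral_mul_const]
  congr 3
  exact funext fun i => A.integral_mul_serve μ i (hμ i)

/-- An algorithm that serves every set equally often and serves each agent at least as much value
has at least as much welfare. -/
theorem welfare_mono (hc : ∀ S, c S ≠ ⊥) (hμ : ∀ i, Integrable (fun v : ℝ≥0 => (v : ℝ)) (μ i))
    {A B : Alg n}
    (hS : ∀ S, ∫ v, B.prob v S ∂(Measure.pi μ) = ∫ v, A.prob v S ∂(Measure.pi μ))
    (hx : ∀ i, ∫ t, (t : ℝ) * A.interim μ i t ∂(μ i) ≤ ∫ t, (t : ℝ) * B.interim μ i t ∂(μ i)) :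
    welfare c μ A ≤ welfare c μ B := by
  by_cases h : ∀ S, c S = ⊤ → ∫ v, A.prob v S ∂(Measure.pi μ) = 0
  · rw [welfare_eq_coe hc hμ A h, welfare_eq_coe hc hμ B fun S hcS => (hS S).trans (h S hcS),
      EReal.coe_le_coe_iff]
    simp_rw [hS]
    exact sub_le_sub_right (Finset.sum_le_sum fun i _ => hx i) _
  · push Not at h
    obtain ⟨S, hcS, hne⟩ := h
    rw [welfare_eq_bot A hcS hne]
    exact bot_le

end Welfare

/-! ### Monotone payments -/

/-- The mechanism that charges each agent the interim payment making its interim rule truthful. -/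
noncomputable def Alg.payMech {n : ℕ} (A : Alg n) (μ : Fin n → Measure ℝ≥0) : Mech n where
  alg := A
  pay v i := (v i : ℝ) * A.interim μ i (v i) - ∫ z in (0 : ℝ)..(v i), A.interim μ i z.toNNReal

section Payments

variable {n : ℕ} (A : Alg n) (μ : Fin n → Measure ℝ≥0) [∀ i, IsProbabilityMeasure (μ i)]

theorem Alg.interimPay_payMech (i : Fin n) (t : ℝ≥0) :
    (A.payMech μ).interimPay μ i t =
      (t : ℝ) * A.interim μ i t - ∫ z in (0 : ℝ)..t, A.interim μ i z.toNNReal := by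
  simp [Mech.interimPay, Alg.payMech]

/-- With value `t`, bidding `b` instead of `t` loses the signed integral from `b` to `t` of `x(z) -
x(b)`, which is nonnegative for monotone `x` in either order of `b` and `t`. -/
theorem Alg.isBIC_payMech (h : ∀ i, Monotone (A.interim μ i)) : (A.payMech μ).IsBIC μ := by
  refine fun i => ⟨fun b => ?_, fun t b => ?_⟩
  · simp only [Alg.payMech, Function.update_self]
    exact integrable_const _
  · rw [Alg.interimPay_payMech, Alg.interimPay_payMech]
    change (t : ℝ) * A.interim μ i b - _ ≤ (t : ℝ) * A.interim μ i t - _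
    have hmono : Monotone fun z : ℝ => A.interim μ i z.toNNReal :=
      (h i).comp fun _ _ => Real.toNNReal_mono
    have hadd := intervalIntegral.integral_add_adjacent_intervals
      (hmono.intervalIntegrable (a := (0 : ℝ)) (b := b) (μ := volume))
      (hmono.intervalIntegrable (a := (b : ℝ)) (b := t) (μ := volume))
    have key : ((t : ℝ) - b) * A.interim μ i b ≤
        ∫ z in (b : ℝ)..t, A.interim μ i z.toNNReal := by
      rcases le_total b t with hbt | htb
      · have := intervalIntegral.integral_mono_on (a := (b : ℝ)) (b := t) (μ := volume)
          (NNReal.coe_le_coe.2 hbt) intervalIntegrable_const hmono.intervalIntegrable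
          (fun z hz => (show A.interim μ i b ≤ A.interim μ i z.toNNReal from by
            simpa using hmono hz.1))
        simpa using this
      · have := intervalIntegral.integral_mono_on (a := (t : ℝ)) (b := b) (μ := volume)
          (NNReal.coe_le_coe.2 htb) hmono.intervalIntegrable intervalIntegrable_const
          (fun z hz => (show A.interim μ i z.toNNReal ≤ A.interim μ i b from by
            simpa using hmono hz.2))
        rw [intervalIntegral.integral_symm]
        simp only [intervalIntegral.integral_const, smul_eq_mul] at this
        linarith
    linarith

end Payments

/-! ### Changing an algorithm on null sets of bids -/

section Patch

variable {n : ℕ}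

open Classical in
/-- Run `A` if every bid `v i` lies in `D i`; otherwise let the first offending bid determine the
probabilities `q i (v i)` with which the sets are served. -/
noncomputable def Alg.patch (A : Alg n) (D : Fin n → Set ℝ≥0) (hD : ∀ i, MeasurableSet (D i))
    (q : Fin n → ℝ≥0 → Finset (Fin n) → ℝ) (hq : ∀ i S, Measurable fun b => q i b S)
    (hq0 : ∀ i b S, 0 ≤ q i b S) (hq1 : ∀ i b, ∑ S, q i b S = 1) : Alg n where
  prob v S := if h : ∃ i, v i ∉ D i then
    q (wellFounded_lt.min {i | v i ∉ D i} h) (v (wellFounded_lt.min {i | v i ∉ D i} h)) S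
    else A.prob v S
  nonneg v S := by split_ifs; exacts [hq0 _ _ _, A.nonneg v S]
  sum_eq_one v := by
    split_ifs with h
    exacts [hq1 _ _, A.sum_eq_one v]
  measurable_prob S := by
    -- Splitting by the first offending agent gives disjoint measurable events, on which `prob` is a
    -- finite sum of indicators.
    have hset : ∀ i, MeasurableSet {v : Profile n | v i ∉ D i ∧ ∀ j < i, v j ∈ D j} := fun i => by
      have : {v : Profile n | v i ∉ D i ∧ ∀ j < i, v j ∈ D j} =
          (Function.eval i ⁻¹' D i)ᶜ ∩ ⋂ j, ⋂ (_ : j < i), Function.eval j ⁻¹' D j := by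
        ext v; simp
      rw [this]
      exact (measurable_pi_apply i (hD i)).compl.inter (.iInter fun j => .iInter fun _ =>
        measurable_pi_apply j (hD j))
    have hall : MeasurableSet {v : Profile n | ∃ i, v i ∉ D i} := by
      have : {v : Profile n | ∃ i, v i ∉ D i} = ⋃ i, (Function.eval i ⁻¹' D i)ᶜ := by
        ext v; simp
      rw [this]
      exact .iUnion fun i => (measurable_pi_apply i (hD i)).compl
    have hsum : Measurable fun v : Profile n => ∑ i,
        {v : Profile n | v i ∉ D i ∧ ∀ j < i, v j ∈ D j}.indicator (fun v => q i (v i) S) v :=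
      Finset.measurable_sum _ fun i _ =>
        ((hq i S).comp (measurable_pi_apply i)).indicator (hset i)
    have hite : Measurable fun v : Profile n => if ∃ i, v i ∉ D i then ∑ i,
        {v : Profile n | v i ∉ D i ∧ ∀ j < i, v j ∈ D j}.indicator (fun v => q i (v i) S) v
        else A.prob v S := Measurable.ite hall hsum (A.measurable_prob S)
    convert! hite using 2 with v
    by_cases h : ∃ i, v i ∉ D i
    · rw [dif_pos h, if_pos h]
      set i := wellFounded_lt.min {i | v i ∉ D i} h
      have hi : v i ∉ D i := wellFounded_lt.min_mem {i | v i ∉ D i} h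
      have hmin : ∀ j < i, v j ∈ D j := fun j hj => by
        by_contra hn
        exact wellFounded_lt.not_lt_min {i | v i ∉ D i} hn hj
      rw [Finset.sum_eq_single i, indicator_of_mem]
      · exact ⟨hi, hmin⟩
      · intro j _ hj
        refine indicator_of_notMem (fun hmem => ?_) _
        rcases lt_or_gt_of_ne hj with h' | h'
        · exact hmem.1 (hmin j h')
        · exact hi (hmem.2 i h')
      · simp
    · rw [dif_neg h, if_neg h]

variable {A : Alg n} {D : Fin n → Set ℝ≥0} {hD : ∀ i, MeasurableSet (D i)}
  {q : Fin n → ℝ≥0 → Finset (Fin n) → ℝ} {hq : ∀ i S, Measurable fun b => q i b S}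
  {hq0 : ∀ i b S, 0 ≤ q i b S} {hq1 : ∀ i b, ∑ S, q i b S = 1}

theorem Alg.patch_prob_of_forall_mem {v : Profile n} (hv : ∀ i, v i ∈ D i) :
    (A.patch D hD q hq hq0 hq1).prob v = A.prob v := by
  funext S
  exact dif_neg fun ⟨i, hi⟩ => hi (hv i)

theorem Alg.patch_prob_of_unique {v : Profile n} {i : Fin n} (hi : v i ∉ D i)
    (hv : ∀ j ≠ i, v j ∈ D j) (S : Finset (Fin n)) :
    (A.patch D hD q hq hq0 hq1).prob v S = q i (v i) S := by
  have h : ∃ i, v i ∉ D i := ⟨i, hi⟩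
  have hmem : v (wellFounded_lt.min {i | v i ∉ D i} h) ∉ D (wellFounded_lt.min {i | v i ∉ D i} h) :=
    wellFounded_lt.min_mem {i | v i ∉ D i} h
  have hmin : wellFounded_lt.min {i | v i ∉ D i} h = i := by
    by_contra hne
    exact hmem (hv _ hne)
  simp only [Alg.patch]
  rw [dif_pos h, hmin]

theorem Alg.patch_pos {F : Finset (Fin n) → Prop} (hA : ∀ v S, 0 < A.prob v S → F S)
    (hF : ∀ i b S, 0 < q i b S → F S) (v : Profile n) (S : Finset (Fin n))
    (h : 0 < (A.patch D hD q hq hq0 hq1).prob v S) : F S := by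
  simp only [Alg.patch] at h
  split_ifs at h
  exacts [hF _ _ _ h, hA _ _ h]

variable (μ : Fin n → Measure ℝ≥0) [∀ i, IsProbabilityMeasure (μ i)]

omit [∀ i, IsProbabilityMeasure (μ i)] in
theorem ae_forall_mem [∀ i, SigmaFinite (μ i)] (h0 : ∀ i, μ i (D i)ᶜ = 0) :
    ∀ᵐ w ∂(Measure.pi μ), ∀ i, w i ∈ D i := by
  refine ae_all_iff.2 fun i => ?_
  have : ∀ᵐ t ∂(μ i), t ∈ D i := h0 i
  exact (Measure.tendsto_eval_ae_ae (μ := μ) (i := i)).eventually this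

/-- The other bids almost surely lie in their sets. A bid in `D i` therefore leaves `A` unchanged,
and any other bid makes `i` the only offender, so the lottery `q i b` alone decides. -/
theorem Alg.interim_patch (h0 : ∀ i, μ i (D i)ᶜ = 0) {g : Fin n → ℝ≥0 → ℝ}
    (hg : ∀ i, EqOn (g i) (A.interim μ i) (D i))
    (hgq : ∀ i b, ∑ S, (if i ∈ S then q i b S else 0) = g i b) (i : Fin n) :
    (A.patch D hD q hq hq0 hq1).interim μ i = g i := by
  funext b
  by_cases hb : b ∈ D i
  · rw [hg i hb]
    refine integral_congr_ae ?_
    filter_upwards [ae_forall_mem μ h0] with w hw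
    rw [Alg.serve, Alg.serve, Alg.patch_prob_of_forall_mem]
    intro j
    by_cases hj : j = i
    · subst hj; simpa using hb
    · simpa [hj] using hw j
  · have : (fun w => (A.patch D hD q hq hq0 hq1).serve (Function.update w i b) i)
        =ᵐ[Measure.pi μ] fun _ => g i b := by
      filter_upwards [ae_forall_mem μ h0] with w hw
      rw [Alg.serve, ← hgq i b]
      refine Finset.sum_congr rfl fun S _ => ?_
      rw [Alg.patch_prob_of_unique (i := i) (by simpa using hb) fun j hj => by
        simpa [hj] using hw j, Function.update_self]
    rw [Alg.interim, integral_congr_ae this]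
    simp

/-- A monotone extension of an interim rule, and lotteries over feasible sets that realize it. -/
theorem Alg.exists_lottery (A : Alg n) (i : Fin n) {E : Set ℝ≥0}
    (hE : MonotoneOn (A.interim μ i) E) :
    ∃ (g : ℝ≥0 → ℝ) (q : ℝ≥0 → Finset (Fin n) → ℝ), Monotone g ∧ EqOn g (A.interim μ i) E ∧
      (∀ S, Measurable fun b => q b S) ∧ (∀ b S, 0 ≤ q b S) ∧ (∀ b, ∑ S, q b S = 1) ∧
      (∀ b S, 0 < q b S → ∃ w, 0 < A.prob w S) ∧
      ∀ b, ∑ S, (if i ∈ S then q b S else 0) = g b := by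
  -- The lottery serves `S₁` with probability `g b` and `S₀` otherwise; the two sets may coincide.
  have mix : ∀ (g : ℝ≥0 → ℝ) (S₁ S₀ : Finset (Fin n)), Monotone g → (∀ b, 0 ≤ g b) →
      (∀ b, g b ≤ 1) → EqOn g (A.interim μ i) E → (∃ w, 0 < A.prob w S₁) →
      (∃ w, 0 < A.prob w S₀) →
      (∀ b, (if i ∈ S₁ then g b else 0) + (if i ∈ S₀ then 1 - g b else 0) = g b) →
      ∃ (g : ℝ≥0 → ℝ) (q : ℝ≥0 → Finset (Fin n) → ℝ), Monotone g ∧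
      EqOn g (A.interim μ i) E ∧
      (∀ S, Measurable fun b => q b S) ∧ (∀ b S, 0 ≤ q b S) ∧ (∀ b, ∑ S, q b S = 1) ∧
      (∀ b S, 0 < q b S → ∃ w, 0 < A.prob w S) ∧
      ∀ b, ∑ S, (if i ∈ S then q b S else 0) = g b := by
    intro g S₁ S₀ hg hg0 hg1 hgE h1 h0 hmix
    refine ⟨g, fun b S => (if S = S₁ then g b else 0) + (if S = S₀ then 1 - g b else 0), hg, hgE,
      fun S => ?_, fun b S => ?_, fun b => ?_, fun b S hpos => ?_, fun b => ?_⟩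
    · refine Measurable.add ?_ ?_ <;> split_ifs
      exacts [hg.measurable, measurable_const, measurable_const.sub hg.measurable,
        measurable_const]
    · refine add_nonneg ?_ ?_ <;> split_ifs
      exacts [hg0 b, le_rfl, sub_nonneg.2 (hg1 b), le_rfl]
    · simp [Finset.sum_add_distrib]
    · by_cases hS₁ : S = S₁
      · exact hS₁ ▸ h1
      · by_cases hS₀ : S = S₀
        · exact hS₀ ▸ h0
        · simp [hS₁, hS₀] at hpos
    · rw [← hmix b]
      have : ∀ S : Finset (Fin n), (if i ∈ S then (if S = S₁ then g b else 0) +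
          (if S = S₀ then 1 - g b else 0) else 0) =
          (if S = S₁ then (if i ∈ S₁ then g b else 0) else 0) +
          (if S = S₀ then (if i ∈ S₀ then 1 - g b else 0) else 0) := by
        intro S
        by_cases hS₁ : S = S₁ <;> by_cases hS₀ : S = S₀ <;> by_cases hi : i ∈ S <;>
          simp_all
      simp_rw [this, Finset.sum_add_distrib]
      simp
  have hprob : ∀ v S, A.prob v S ≠ 0 → ∃ w, 0 < A.prob w S := fun v S h =>
    ⟨v, lt_of_le_of_ne (A.nonneg v S) (Ne.symm h)⟩
  obtain ⟨S, -, hS⟩ : ∃ S ∈ Finset.univ, A.prob (fun _ => 0) S ≠ 0 :=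
    Finset.exists_ne_zero_of_sum_ne_zero (by rw [A.sum_eq_one]; exact one_ne_zero)
  -- If one feasible set contains `i` and another omits it, every probability can be realized by
  -- mixing them. Otherwise the interim rule is constantly 1 or 0, and the single feasible set `S`
  -- will do.
  by_cases h1 : ∃ S, (∃ w, 0 < A.prob w S) ∧ i ∈ S
  · by_cases h0 : ∃ S, (∃ w, 0 < A.prob w S) ∧ i ∉ S
    · obtain ⟨S₁, hS₁, hi₁⟩ := h1
      obtain ⟨S₀, hS₀, hi₀⟩ := h0
      obtain ⟨g, hg, hgE⟩ := hE.exists_monotone_extension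
        ⟨0, by rintro _ ⟨b, -, rfl⟩; exact A.interim_nonneg μ i b⟩
        ⟨1, by rintro _ ⟨b, -, rfl⟩; exact A.interim_le_one μ i b⟩
      -- Clamping makes the extension a probability; on `E` it changes nothing, as interim
      -- probabilities already lie in the unit interval.
      refine mix (fun b => max 0 (min 1 (g b))) S₁ S₀
        (monotone_const.max (monotone_const.min hg)) (fun b => le_max_left _ _)
        (fun b => max_le zero_le_one (min_le_left _ _)) (fun b hb => ?_) hS₁ hS₀ fun b => ?_
      · simp only
        rw [hgE hb, min_eq_right ((hgE hb).symm.trans_le (A.interim_le_one μ i b)),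
          max_eq_right ((A.interim_nonneg μ i b).trans_eq (hgE hb))]
      · simp [hi₁, hi₀]
    · push Not at h0
      have hserve : ∀ v, A.serve v i = 1 := fun v => by
        rw [← A.sum_eq_one v]
        refine Finset.sum_congr rfl fun T _ => ?_
        by_cases hT : A.prob v T = 0
        · simp [hT]
        · rw [if_pos (h0 T (hprob v T hT))]
      refine mix (fun _ => 1) S S monotone_const (fun _ => zero_le_one) (fun _ => le_rfl)
        (fun b _ => ?_) (hprob _ S hS) (hprob _ S hS) fun b => ?_
      · simp [Alg.interim, hserve]
      · simp [h0 S (hprob _ S hS)]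
  · push Not at h1
    have hserve : ∀ v, A.serve v i = 0 := fun v => by
      refine Finset.sum_eq_zero fun T _ => ?_
      by_cases hT : A.prob v T = 0
      · simp [hT]
      · rw [if_neg (h1 T (hprob v T hT))]
    refine mix (fun _ => 0) S S monotone_const (fun _ => le_rfl) (fun _ => zero_le_one)
      (fun b _ => ?_) (hprob _ S hS) (hprob _ S hS) fun b => ?_
    · simp [Alg.interim, hserve]
    · simp [h1 S (hprob _ S hS)]

theorem Alg.exists_monotone_modification (A : Alg n) (hD : ∀ i, MeasurableSet (D i))
    (h0 : ∀ i, μ i (D i)ᶜ = 0) (hmono : ∀ i, MonotoneOn (A.interim μ i) (D i)) :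
    ∃ M : Alg n, (∀ v, (∀ i, v i ∈ D i) → M.prob v = A.prob v) ∧
      (∀ v S, 0 < M.prob v S → ∃ w, 0 < A.prob w S) ∧ ∀ i, Monotone (M.interim μ i) := by
  choose g q hg hgD hq hq0 hq1 hpos hgq using fun i => A.exists_lottery μ i (hmono i)
  refine ⟨A.patch D hD q hq hq0 hq1, fun v hv => Alg.patch_prob_of_forall_mem hv,
    Alg.patch_pos (fun v S h => ⟨v, h⟩) hpos, fun i => ?_⟩
  rw [Alg.interim_patch μ h0 hgD hgq]
  exact hg i

end Patch

end Ironing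

theorem mainTheorem3 {n : ℕ} (c : Finset (Fin n) → EReal) (hc : ∀ S, c S ≠ ⊥)
    (μ : Fin n → Measure ℝ≥0) [∀ i, IsProbabilityMeasure (μ i)] (hna : ∀ i v, μ i {v} = 0)
    (hμ : ∀ i, Integrable (fun v : ℝ≥0 => (v : ℝ)) (μ i))
    (β : ℝ) (hβ : 0 < β) (A : Ironing.Alg n) (hA : Ironing.IsBayesianApprox c μ β A) :
    -- redrawing a bid is well defined and preserves the distribution of the bid
    (∀ i, Measurable (Ironing.redraw (μ i) (A.interim μ i)) ∧
      (∀ v, IsProbabilityMeasure (Ironing.redraw (μ i) (A.interim μ i) v)) ∧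
      (μ i).bind (Ironing.redraw (μ i) (A.interim μ i)) = μ i) ∧
    -- the ironed algorithm
    ∃ Abar : Ironing.Alg n, Ironing.IsIroned μ A Abar ∧
      -- no agent is affected by the redraws of the others
      (∀ i v, Abar.interim μ i v =
        ∫ w, A.interim μ i w ∂(Ironing.redraw (μ i) (A.interim μ i) v)) ∧
      -- the value served to each agent, and the social welfare, weakly increase
      (∀ i, ∫ v, (v : ℝ) * A.interim μ i v ∂(μ i) ≤
        ∫ v, (v : ℝ) * Abar.interim μ i v ∂(μ i)) ∧
      Ironing.welfare c μ A ≤ Ironing.welfare c μ Abar ∧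
      Ironing.IsBayesianApprox c μ β Abar ∧
      -- the interim rules are monotone outside null sets of values, and a BIC mechanism
      -- is obtained by changing the algorithm only when some bid lies in those null sets
      ∃ D : Fin n → Set ℝ≥0,
        (∀ i, MeasurableSet (D i) ∧ μ i (D i)ᶜ = 0 ∧ MonotoneOn (Abar.interim μ i) (D i)) ∧
        ∃ M : Ironing.Mech n,
          (∀ v : Ironing.Profile n, (∀ i, v i ∈ D i) → M.alg.prob v = Abar.prob v) ∧
          (∀ v S, 0 < M.alg.prob v S → ∃ w, 0 < A.prob w S) ∧
          (∀ i, Monotone (M.alg.interim μ i)) ∧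
          (∀ i t, M.interimPay μ i t = (t : ℝ) * M.alg.interim μ i t -
            ∫ z in (0 : ℝ)..t, M.alg.interim μ i z.toNNReal) ∧
          M.IsBIC μ ∧
          Ironing.welfare c μ A ≤ Ironing.welfare c μ M.alg ∧
          Ironing.IsBayesianApprox c μ β M.alg := by
  have hatom : ∀ i, NullSingletonClass (μ i) := fun i => ⟨hna i⟩
  have hm : ∀ i, Measurable (A.interim μ i) := A.measurable_interim μ
  have h0 : ∀ i v, 0 ≤ A.interim μ i v := A.interim_nonneg μ
  have h1 : ∀ i v, A.interim μ i v ≤ 1 := A.interim_le_one μ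
  have hκ : ∀ i, Measurable (Ironing.redraw (μ i) (A.interim μ i)) := fun i =>
    Ironing.measurable_redraw (hm i) (h0 i) (h1 i)
  have hp : ∀ i v, IsProbabilityMeasure (Ironing.redraw (μ i) (A.interim μ i) v) := fun i =>
    Ironing.isProbabilityMeasure_redraw (hm i) (h0 i) (h1 i)
  have hinv : ∀ i, (μ i).bind (Ironing.redraw (μ i) (A.interim μ i)) = μ i := fun i =>
    Ironing.bind_redraw (hm i) (h0 i) (h1 i)
  refine ⟨fun i => ⟨hκ i, hp i, hinv i⟩, ?_⟩
  set B := A.resample _ hκ hp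
  have hint : ∀ i, B.interim μ i = Ironing.ironed (μ i) (A.interim μ i) := fun i =>
    funext fun v => Ironing.Alg.interim_resample hinv i v
  have hval : ∀ i, ∫ v, (v : ℝ) * A.interim μ i v ∂(μ i) ≤
      ∫ v, (v : ℝ) * B.interim μ i v ∂(μ i) := fun i =>
    Ironing.integral_mul_le_of_setIntegral_Ioi_le (hμ i) (hm i) (h0 i) (h1 i)
      (B.measurable_interim μ i) (B.interim_nonneg μ i) (B.interim_le_one μ i) fun t => by
        rw [hint]
        exact Ironing.setIntegral_Ioi_le_ironed (hm i) (h0 i) (h1 i) t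
  have hwel : Ironing.welfare c μ A ≤ Ironing.welfare c μ B :=
    Ironing.welfare_mono hc hμ (Ironing.Alg.integral_prob_resample hinv) hval
  choose D hDm hD0 hDmono using fun i =>
    Ironing.exists_monotoneOn_ironed (ν := μ i) (hm i) (h0 i) (h1 i)
  have hmono : ∀ i, MonotoneOn (B.interim μ i) (D i) := fun i => by rw [hint]; exact hDmono i
  obtain ⟨M, hMB, hMpos, hMmono⟩ := B.exists_monotone_modification μ hDm hD0 hmono
  have hMwel : Ironing.welfare c μ M = Ironing.welfare c μ B := by
    refine Ironing.extExpect_congr ?_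
    filter_upwards [Ironing.ae_forall_mem μ hD0] with v hv
    rw [Ironing.welfareAt, Ironing.welfareAt, hMB v hv]
  have hwelM : Ironing.welfare c μ A ≤ Ironing.welfare c μ M := hMwel ▸ hwel
  refine ⟨B, fun v S => rfl, fun i v => Ironing.Alg.interim_resample hinv i v, hval, hwel,
    hA.trans hwel, D, fun i => ⟨hDm i, hD0 i, hmono i⟩, M.payMech μ, hMB, fun v S h => ?_, hMmono,
    M.interimPay_payMech μ, M.isBIC_payMech μ hMmono, hwelM, hA.trans hwelM⟩
  obtain ⟨w, hw⟩ := hMpos v S h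
  exact Ironing.Alg.exists_prob_pos_of_resample hw
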